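/- **Setting.** A wildcard string of length $n$ over an alphabet $\Sigma$ is a sequence $S=S[1]\dots S[n]$ over $\Sigma\cup\{\phi\}$, where the wildcard $\phi$ matches every character and two letters match iff they are equal. A factor $S[i\mathinner{.\,.}j]$ is a palindrome if it matches its reverse position by position. For a position $c$, the radius $r_c$ is the $r$ for which $S[c-r\mathinner{.\,.}c+r]$ is a palindrome and $S[c-r-1\mathinner{.\,.}c+r+1]$ is undefined or not a palindrome (only odd-length palindromes are considered). For a string $T$ of length $m$, its matching self-convolution $\mathrm{mconv}(T)$ is the $0/1$ array $M[1\mathinner{.\,.}2m-1]$ with $M[i]=1$ iff $T[a]$ matches $T[b]$ for all $1\le a,b\le m$ with $a+b=i+1$. **Algorithm** (input $S$ of length $n$ and $0<\epsilon\le\frac12$). Put $\delta=\epsilon/2$, let $u_0$ be the least power of two with $u_0\ge 1/\delta$, and put $u=u'=u_0$. For every $c\in\{1,\dots,n\}$ find $\tilde R[c]=\min(u_0,r_c)$ by comparing characters one by one. Let $\mathcal A$ be the list of anchors $iu_0/2$, $1\le i\le 2n/u_0$. While $u<n/2$, perform a round: 1. For each $a\in\mathcal A$ put $\ell=\max\{1,a-\lfloor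 u\rfloor\}$ and $r=\min\{n,a+\lfloor u\rfloor\}$, compute $M=\mathrm{mconv}(S[\ell\mathinner{.\,.}r])$, and for each $c\in[\ell,r]$ with $M[2(c-\ell)+1]=1$ (that is, $S[\ell\mathinner{.\,.}r]$ has a palindromic prefix or suffix centered at $c$) set $\tilde R[c]\leftarrow\max\{\tilde R[c],\min(c-\ell,r-c)\}$. 2. Set $u\leftarrow(1+\delta)u$. 3. If now $u\ge 2u'$, set $u'\leftarrow 2u'$ and keep only every second anchor, $\mathcal A\leftarrow(\mathcal A[2],\mathcal A[4],\dots)$. Return $\tilde R$. The algorithm is run as an explicit program on a random access machine with exact real and complex arithmetic (letters are presented as natural numbers), in which each arithmetic operation, evaluation of sine or cosine, comparison, memory access and loop jump takes one step; space is the number of memory cells used, including the input and the output. The self-convolutions are computed by a subroutine, part of the program, that uses the fast Fourier transform. **Lemma (Runtime).** There is an absolute constant $C>0$ such that for every alphabet (with letters coded injectively by natural numbers), every wildcard string $S$ of length $n\ge2$ and every $0<\epsilon\le\frac12$ the following hold. - The algorithm terminates after at most $C\,\frac1\epsilon\,n\log^2 n$ steps and uses at most $C\,n$ memory cells. - It performs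 at most $C\,\frac1\epsilon\log n$ rounds, and a round with window size $u$ computes at most $C\,n/u$ self-convolutions, each of a string of length at most $C\,u$. - If $n$ is a power of two, the output is a $(1+\epsilon)$-approximation of all maximal radii: $\tilde R[c]\le r_c\le(1+\epsilon)\tilde R[c]$ for every $1\le c\le n$. - For all $1\le\ell\le r\le n$, the convolution subroutine computes $\mathrm{mconv}(S[\ell\mathinner{.\,.}r])$. -/

import Mathlib

noncomputable section

namespace WildPal

/-! ## Wildcard strings, palindromes and matching convolutions

A wildcard string over the alphabet `α` is a `List (Option α)`; the character `none` is the
wildcard. Positions are counted from `1`, as in the notation `S[i .. j]`. -/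

/-- Two characters match when they are equal or one of them is the wildcard. -/
def Matches {α : Type*} (x y : Option α) : Prop :=
  x = none ∨ y = none ∨ x = y

open Classical in
/-- The number of mismatching positions of two strings of equal length. -/
def hamming {α : Type*} (T P : List (Option α)) : ℕ :=
  (T.zip P).countP (fun p => decide (¬ Matches p.1 p.2))

/-- The factor `S[i .. j]` (for `1 ≤ i`), empty when `j < i`. -/
def factor {α : Type*} (S : List (Option α)) (i j : ℕ) : List (Option α) :=
  (S.drop (i - 1)).take (j + 1 - i)

/-- The counting convolution array of `T` and `P`, where `|P| ≤ |T|`;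
the meaningful indices are `1 ≤ i ≤ |T| + |P| - 1`. -/
def cconv {α : Type*} (T P : List (Option α)) (i : ℕ) : ℕ :=
  if i < P.length then
    hamming (factor T 1 i) (factor P (P.length - i + 1) P.length)
  else if i ≤ T.length then
    hamming (factor T (i - P.length + 1) i) P
  else
    hamming (factor T (i - P.length + 1) T.length) (factor P 1 (T.length + P.length - i))

/-- The matching convolution array of `T` and `P`. -/
def mconv {α : Type*} (T P : List (Option α)) (i : ℕ) : ℕ :=
  if cconv T P i = 0 then 1 else 0

/-- A string is a palindrome when it matches its reverse at every position. -/
def IsPalindrome {α : Type*} (S : List (Option α)) : Prop :=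
  List.Forall₂ Matches S S.reverse

/-- The interval `[i .. j]` is a subpalindrome of `S`. -/
def IsSubpalindrome {α : Type*} (S : List (Option α)) (i j : ℕ) : Prop :=
  1 ≤ i ∧ i ≤ j ∧ j ≤ S.length ∧ IsPalindrome (factor S i j)

/-- The interval `[i .. j]` is a maximal subpalindrome of `S`. -/
def IsMaximalSubpalindrome {α : Type*} (S : List (Option α)) (i j : ℕ) : Prop :=
  IsSubpalindrome S i j ∧ ¬ IsSubpalindrome S (i - 1) (j + 1)

/-- `r` is the radius of the maximal (odd-length) subpalindrome `[c - r .. c + r]` centered at `c`. -/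
def IsMaximalRadius {α : Type*} (S : List (Option α)) (c r : ℕ) : Prop :=
  r < c ∧ IsMaximalSubpalindrome S (c - r) (c + r)

/-! ## The machine

A unit-cost random access machine with exact arithmetic. Its memory consists of four arrays of
natural numbers and five arrays of complex numbers. Local variables of a program (always single
numbers or truth values, a bounded number of them) are registers. Every arithmetic operation,
every comparison or logical operation, every memory access and every jump of a loop takes one step. -/

/-- The arrays that hold natural numbers. -/
inductive NArr
  /-- the input string -/
  | str
  /-- the radius lower bounds, which are the output -/
  | rad
  /-- the anchors -/
  | anch
  /-- the matching convolution array computed last -/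
  | mat
  deriving DecidableEq

/-- The arrays that hold complex numbers. -/
inductive CArr
  /-- convolution buffers -/
  | x1 | x2 | x3
  /-- auxiliary buffer of the Fourier transform -/
  | tmp
  /-- table of the powers of a root of unity -/
  | root
  deriving DecidableEq

/-- A machine configuration. -/
structure Machine where
  /-- contents of the arrays of natural numbers -/
  nat : NArr → ℕ → ℕ
  /-- contents of the arrays of complex numbers -/
  cpx : CArr → ℕ → ℂ
  /-- number of steps made so far -/
  time : ℕ
  /-- for each array, one more than the largest address accessed so far (`0` if there is none) -/
  natTop : NArr → ℕ
  /-- likewise for the arrays of complex numbers -/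
  cpxTop : CArr → ℕ
  /-- a log that programs cannot read: for every round of the main loop, the most recent one
  first, the window size `u` and the lengths of the strings whose self-convolution was computed -/
  rounds : List (ℝ × List ℕ)

/-- The number of memory cells that the computation has needed so far. -/
def Machine.space (m : Machine) : ℕ :=
  m.natTop .str + m.natTop .rad + m.natTop .anch + m.natTop .mat +
    (m.cpxTop .x1 + m.cpxTop .x2 + m.cpxTop .x3 + m.cpxTop .tmp + m.cpxTop .root)

/-- Programs: partial (a loop may fail to terminate) state transformers with a result. -/
abbrev Prog (β : Type) := StateT Machine Part β

/-- The machine makes one step. -/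
def tick : Prog Unit :=
  modify fun m => { m with time := m.time + 1 }

/-- One step that computes a value `v` from the registers. Each use below performs a single
arithmetic operation, comparison or logical operation. -/
def op {β : Type} (v : β) : Prog β := do
  tick
  pure v

/-- Read a cell of an array of natural numbers. -/
def readN (a : NArr) (i : ℕ) : Prog ℕ := do
  tick
  modify fun m => { m with natTop := Function.update m.natTop a (max (m.natTop a) (i + 1)) }
  let m ← get
  pure (m.nat a i)

/-- Write a cell of an array of natural numbers. -/
def writeN (a : NArr) (i v : ℕ) : Prog Unit := do
  tick
  modify fun m => { m with
    natTop := Function.update m.natTop a (max (m.natTop a) (i + 1))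
    nat := Function.update m.nat a (Function.update (m.nat a) i v) }

/-- Read a cell of an array of complex numbers. -/
def readC (a : CArr) (i : ℕ) : Prog ℂ := do
  tick
  modify fun m => { m with cpxTop := Function.update m.cpxTop a (max (m.cpxTop a) (i + 1)) }
  let m ← get
  pure (m.cpx a i)

/-- Write a cell of an array of complex numbers. -/
def writeC (a : CArr) (i : ℕ) (v : ℂ) : Prog Unit := do
  tick
  modify fun m => { m with
    cpxTop := Function.update m.cpxTop a (max (m.cpxTop a) (i + 1))
    cpx := Function.update m.cpx a (Function.update (m.cpx a) i v) }

/-- Log the beginning of a round with window size `u`. -/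
def logRound (u : ℝ) : Prog Unit :=
  modify fun m => { m with rounds := (u, []) :: m.rounds }

/-- Log the computation of a self-convolution of a string of length `len`. -/
def logConv (len : ℕ) : Prog Unit :=
  modify fun m => { m with
    rounds := match m.rounds with
      | [] => []
      | (u, L) :: t => (u, len :: L) :: t }

/-- One pass of a loop with the test `cond` and the body `body`, from the values of the registers
`σ` that the loop changes and the configuration of the machine: `Sum.inr` of the new values when
the test succeeds, `Sum.inl` of the final values when it fails. -/
def whileStep {σ : Type} (cond : σ → Prog Bool) (body : σ → Prog σ) :
    σ × Machine →. (σ × Machine) ⊕ (σ × Machine) := fun p =>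
  ((do
      let b ← cond p.1
      tick
      if b then do
        let t ← body p.1
        pure (true, t)
      else
        pure (false, p.1) : Prog (Bool × σ)).run p.2).map
    fun q => if q.1.1 then Sum.inr (q.1.2, q.2) else Sum.inl (q.1.2, q.2)

/-- `while cond do body`, where `s : σ` are the registers that the loop changes.
There is no result if the loop does not terminate. -/
def whileLoop {σ : Type} (cond : σ → Prog Bool) (body : σ → Prog σ) (s : σ) : Prog σ :=
  fun m => (whileStep cond body).fix (s, m)

/-- `for i = 0, …, k - 1 do body i`; each test and each increment of the counter takes a step. -/
def forLoop : ℕ → (ℕ → Prog Unit) → Prog Unit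
  | 0, _ => tick
  | k + 1, body => do
    forLoop k body
    body k
    tick
    tick

/-! ## The Fourier transform and the matching convolution on the machine -/

/-- Fill the table with `1, ω, …, ω ^ (N - 1)`. -/
def fillRoots (N : ℕ) (ω : ℂ) : Prog Unit := do
  writeC .root 0 1
  forLoop (N - 1) fun j => do
    let x ← readC .root j
    let y ← op (x * ω)
    let j1 ← op (j + 1)
    writeC .root j1 y

/-- Fast Fourier transform (in Stockham's form) of the first `N` entries of the array `b`, for a
power of two `N`: when the table holds the powers of an `N`-th root of unity `ω`,
`b[k]` becomes `∑ j < N, b[j] * ω ^ (j * k)`. -/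
def fft (N : ℕ) (b : CArr) : Prog Unit := do
  let h ← op (N / 2)
  let _ ← whileLoop
    (fun s : ℕ => op (decide (s < N)))
    (fun s => do
      forLoop h fun i => do
        let q ← op (i % s)
        let k ← op (i - q)
        let j ← op (i + h)
        let x ← readC b i
        let y ← readC b j
        let w ← readC .root k
        let d ← op (x + y)
        let e ← op (x - y)
        let e ← op (e * w)
        let o ← op (i + k)
        writeC .tmp o d
        let o ← op (o + s)
        writeC .tmp o e
      forLoop N fun i => do
        let x ← readC .tmp i
        writeC b i x
      op (2 * s))
    1
  pure ()

/-- The matching self-convolution of the factor `S[l .. r]` of the input string: with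
`len = r - l + 1`, it stores `mconv (S[l .. r])` in the entries `1, …, 2 * len - 1` of the array
`mat`. If the characters are coded by `x`, and the wildcard by `0`, the `i`-th alignment matches
exactly when `∑ x a * x b * (x a - x b) ^ 2 = 0` over the pairs of positions with `a + b = i + 1`,
that is, when the convolutions of `x ^ 3` with `x` and of `x ^ 2` with itself agree there. The
inverse transform is not normalized, since its entries are only compared with `0`. -/
def mconvProg (l r : ℕ) : Prog Unit := do
  let len ← op (r - l)
  let len ← op (len + 1)
  logConv len
  let len2 ← op (2 * len)
  let N ← whileLoop (fun p : ℕ => op (decide (p < len2))) (fun p => op (2 * p)) 1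
  forLoop len fun j => do
    let i ← op (l + j)
    let x ← readN .str i
    let x2 ← op (x * x)
    let x3 ← op (x2 * x)
    writeC .x1 j (x : ℂ)
    writeC .x2 j (x2 : ℂ)
    writeC .x3 j (x3 : ℂ)
  let pad ← op (N - len)
  forLoop pad fun j => do
    let i ← op (len + j)
    writeC .x1 i 0
    writeC .x2 i 0
    writeC .x3 i 0
  let θ ← op ((2 * Real.pi) / N) -- the number `2 * π` is a constant of the program
  let a ← op (Real.cos θ)
  let b ← op (Real.sin θ)
  fillRoots N ⟨a, b⟩
  fft N .x1
  fft N .x2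
  fft N .x3
  forLoop N fun i => do
    let p ← readC .x1 i
    let q ← readC .x2 i
    let s ← readC .x3 i
    let d ← op (s * p)
    let e ← op (q * q)
    let d ← op (d - e)
    writeC .x1 i d
  let b ← op (-b)
  fillRoots N ⟨a, b⟩
  fft N .x1
  let cnt ← op (len2 - 1)
  forLoop cnt fun i => do
    let x ← readC .x1 i
    let z ← op (decide (x = 0))
    let i1 ← op (i + 1)
    if z then writeN .mat i1 1 else writeN .mat i1 0

/-! ## The approximation algorithm -/

/-- The least power of two that is at least `t`. -/
def alignUpToPowerOfTwo (t : ℝ) : Prog ℕ :=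
  whileLoop (fun p : ℕ => op (decide ((p : ℝ) < t))) (fun p => op (2 * p)) 1

/-- Whether the characters with codes `x` and `y` match (the code of the wildcard is `0`). -/
def matchChars (x y : ℕ) : Prog Bool := do
  let bx ← op (decide (x = 0))
  let byy ← op (decide (y = 0))
  let e ← op (decide (x = y))
  let t ← op (bx || byy)
  op (t || e)

/-- Extend the palindrome at center `c` character by character, to radius at most `u`. -/
def naivePalFind (n c u : ℕ) : Prog ℕ :=
  whileLoop
    (fun r : ℕ => do
      let r1 ← op (r + 1)
      let b0 ← op (decide (r1 ≤ u))
      if b0 then do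
        let b1 ← op (decide (r1 < c))
        if b1 then do
          let hi ← op (c + r1)
          let b2 ← op (decide (hi ≤ n))
          if b2 then do
            let lo ← op (c - r1)
            let x ← readN .str lo
            let y ← readN .str hi
            matchChars x y
          else pure false
        else pure false
      else pure false)
    (fun r => op (r + 1))
    0

/-- Treat the window `S[max {1, a - u} .. min {n, a + u}]` of the anchor `a`, where `v = ⌊u⌋`:
compute its matching self-convolution and update the radius lower bounds. -/
def processAnchor (n a v : ℕ) : Prog Unit := do
  let b ← op (decide (v < a))
  let l ← if b then op (a - v) else pure 1
  let e ← op (a + v)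
  let b ← op (decide (e ≤ n))
  let r := if b then e else n
  mconvProg l r
  let len ← op (r - l)
  let len ← op (len + 1)
  forLoop len fun j => do
    let c ← op (l + j)
    let i ← op (2 * j)
    let i ← op (i + 1)
    -- the alignment `i` compares the characters at positions of `S` whose sum is `2 * c`
    let z ← readN .mat i
    let z ← op (decide (z = 1))
    if z then do
      let p ← op (c - l)
      let q ← op (r - c)
      let b ← op (decide (p ≤ q))
      let w := if b then p else q
      let old ← readN .rad c
      let b ← op (decide (old < w))
      if b then writeN .rad c w else pure ()
    else pure ()

/-- The registers that the main loop changes. -/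
structure Regs where
  /-- the window size -/
  u : ℝ
  /-- `⌊u⌋` -/
  v : ℕ
  /-- the largest power of two (times the initial window size) that `u` has reached -/
  u' : ℕ
  /-- the number of anchors -/
  cnt : ℕ

/-- The approximation algorithm: input length `n`, approximation parameter `ε`. The input string
is in the entries `1, …, n` of the array `str`; the output is in the entries `1, …, n` of `rad`. -/
def approxPal (n : ℕ) (ε : ℝ) : Prog Unit := do
  let δ ← op (ε / 2)
  forLoop n fun k => do
    let c ← op (k + 1)
    writeN .rad c 0
  let t ← op (1 / δ)
  let u₀ ← alignUpToPowerOfTwo t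
  forLoop n fun k => do
    let c ← op (k + 1)
    let r ← naivePalFind n c u₀
    writeN .rad c r
  -- the anchors `i * u₀ / 2` for `1 ≤ i ≤ 2 * n / u₀`
  let step ← op (u₀ / 2)
  let cnt ← op (2 * n)
  let cnt ← op (cnt / u₀)
  forLoop cnt fun k => do
    let i ← op (k + 1)
    let a ← op (i * step)
    writeN .anch i a
  let g ← op (1 + δ)
  let half ← op ((n : ℝ) / 2)
  let _ ← whileLoop
    (fun s : Regs => op (decide (s.u < half)))
    (fun s => do
      logRound s.u
      forLoop s.cnt fun k => do
        let i ← op (k + 1)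
        let a ← readN .anch i
        processAnchor n a s.v
      let u ← op (g * s.u)
      let v ← whileLoop
        (fun v : ℕ => do
          let v1 ← op (v + 1)
          op (decide ((v1 : ℝ) ≤ u)))
        (fun v => op (v + 1))
        s.v
      let u2 ← op (2 * s.u')
      let b ← op (decide ((u2 : ℝ) ≤ u))
      if b then do
        -- remove every second anchor
        let h ← op (s.cnt / 2)
        forLoop h fun k => do
          let i ← op (k + 1)
          let i2 ← op (2 * i)
          let a ← readN .anch i2
          writeN .anch i a
        pure { u := u, v := v, u' := u2, cnt := h }
      else
        pure { u := u, v := v, u' := s.u', cnt := s.cnt })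
    { u := (u₀ : ℝ), v := u₀, u' := u₀, cnt := cnt }
  pure ()

/-! ## Input -/

/-- The content of the array `str` for the input string `S`, when the letter `a` has the code
`code a`: the wildcard is stored as `0` and `a` as `code a + 1`. Entry `0` is not used. -/
def inputArray {α : Type*} (code : α ↪ ℕ) (S : List (Option α)) (i : ℕ) : ℕ :=
  if i = 0 then 0
  else match S[i - 1]? with
    | some (some a) => code a + 1
    | _ => 0

/-- The initial configuration: all arrays but the input are zero. -/
def initial {α : Type*} (code : α ↪ ℕ) (S : List (Option α)) : Machine where
  nat := fun a => match a with
    | .str => inputArray code S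
    | _ => fun _ => 0
  cpx := fun _ _ => 0
  time := 0
  natTop := fun _ => 0
  cpxTop := fun _ => 0
  rounds := []

end WildPal

end

/-! The proof combines a cost-aware verification of the program with a geometric argument about
anchors; put `δ = ε / 2`.

Cost. `Runs` is a total-correctness Hoare triple that also bounds time and addresses; its rules
mirror the program constructors, so bounds are assembled from subroutine to caller, up to
`runs_approxPal`. In a round with `u' ≤ u < 2 * u'` there are at most `2 * n / u'` anchors, and each
costs `O(u log n)`, so a round costs `O(n log n)`. Since `u` grows by the factor `1 + δ`, there are
`O(log n / ε)` rounds. The naive initialization costs `O(n * u₀) = O(n / ε)`. Transform lengths stay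
below `4 * n`, hence linear space.

Convolution. Summed over `a + b = i`, the terms `x a ^ 3 * x b - x a ^ 2 * x b ^ 2` symmetrize to
half of `x a * x b * (x a - x b) ^ 2`, which is nonnegative and vanishes exactly on matching pairs
(`sum_mismatch_eq_zero_iff`). The alignment at `2 * c` tests the longest palindrome at `c` inside
the window (`selfMatch_iff_palAt`), so every recorded radius is genuine.

Approximation (`approx_of_treated`). Let `c` have radius `r > u₀`. In round `i` let `v i` be the
floor of the window size `u i`, and `D i` the distance from `c` to the nearest anchor. If `v i - D i
≤ r`, the round certifies the radius `v i - D i`. Take the last such round with `u i < n / 2`. If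
another one follows, then `r < v (i + 1) - D (i + 1) ≤ (1 + δ) * u i - D i`, because anchors only
get sparser. If none follows, then `r + D i ≤ n / 2 ≤ (1 + δ) * u i`, because `n / 2` is an anchor
when `n` is a power of two. As `D i ≤ u i / 4`, both cases give `r ≤ (1 + 2 * δ) * (v i - D i)`,
floors included, up to one small case checked by hand. -/

namespace WildPal

/-! ## Program logic

`Mem` is the part of a configuration that programs can read or log to; `Runs` bounds the time and
the accessed addresses, and describes the effect on `Mem`. -/

/-- The contents of the memory and the log. -/
structure Mem where
  /-- arrays of natural numbers -/
  nat : NArr → ℕ → ℕ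
  /-- arrays of complex numbers -/
  cpx : CArr → ℕ → ℂ
  /-- the log of the rounds -/
  rounds : List (ℝ × List ℕ)

/-- The contents of the memory and the log of a configuration. -/
def Machine.mem (m : Machine) : Mem := ⟨m.nat, m.cpx, m.rounds⟩

/-- Overwrite a cell of an array of natural numbers. -/
def Mem.setN (M : Mem) (a : NArr) (i v : ℕ) : Mem :=
  { M with nat := Function.update M.nat a (Function.update (M.nat a) i v) }

/-- Overwrite a cell of an array of complex numbers. -/
def Mem.setC (M : Mem) (a : CArr) (i : ℕ) (v : ℂ) : Mem :=
  { M with cpx := Function.update M.cpx a (Function.update (M.cpx a) i v) }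

/-- Log the length of a convolution. -/
def pushConv (len : ℕ) : List (ℝ × List ℕ) → List (ℝ × List ℕ)
  | [] => []
  | (u, L) :: t => (u, len :: L) :: t

/-- All addresses accessed so far are less than `B`. -/
def Machine.Bounded (B : ℕ) (m : Machine) : Prop :=
  (∀ a, m.natTop a ≤ B) ∧ ∀ a, m.cpxTop a ≤ B

/-- From every configuration with memory `M`, the program `p` terminates within `t` steps, accesses
only addresses less than `B`, and its result and the final memory satisfy `Q`. -/
def Runs {β : Type} (B : ℕ) (p : Prog β) (t : ℕ) (M : Mem) (Q : β → Mem → Prop) : Prop :=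
  ∀ m : Machine, m.mem = M → m.Bounded B →
    ∃ b m', (b, m') ∈ p.run m ∧ m'.time ≤ m.time + t ∧ m'.Bounded B ∧ Q b m'.mem

namespace Runs

variable {β γ : Type} {B t t₁ t₂ : ℕ} {M : Mem}

theorem mono_time {p : Prog β} {Q : β → Mem → Prop} (ht : t₁ ≤ t₂) (h : Runs B p t₁ M Q) :
    Runs B p t₂ M Q := by
  intro m hm hB
  obtain ⟨b, m', h1, h2, h3, h4⟩ := h m hm hB
  exact ⟨b, m', h1, by omega, h3, h4⟩

theorem mono {p : Prog β} {Q R : β → Mem → Prop} (h : Runs B p t M Q)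
    (hQ : ∀ b M', Q b M' → R b M') : Runs B p t M R := by
  intro m hm hB
  obtain ⟨b, m', h1, h2, h3, h4⟩ := h m hm hB
  exact ⟨b, m', h1, h2, h3, hQ _ _ h4⟩

theorem bind {p : Prog β} {f : β → Prog γ} {R : β → Mem → Prop} {Q : γ → Mem → Prop}
    (hp : Runs B p t₁ M R) (hf : ∀ b M', R b M' → Runs B (f b) t₂ M' Q) :
    Runs B (p >>= f) (t₁ + t₂) M Q := by
  intro m hm hB
  obtain ⟨b, m', h1, h2, h3, h4⟩ := hp m hm hB
  obtain ⟨c, m'', k1, k2, k3, k4⟩ := hf b _ h4 m' rfl h3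
  refine ⟨c, m'', ?_, by omega, k3, k4⟩
  rw [StateT.run_bind]
  exact Part.mem_bind h1 k1

theorem pure {v : β} {Q : β → Mem → Prop} (h : Q v M) : Runs B (Pure.pure v) 0 M Q := by
  intro m hm hB
  refine ⟨v, m, ?_, le_rfl, hB, hm ▸ h⟩
  rw [StateT.run_pure]
  exact Part.mem_some _

theorem modify {f : Machine → Machine} {M' : Mem} {Q : Unit → Mem → Prop}
    (hf : ∀ m : Machine, m.mem = M → m.Bounded B →
      (f m).time ≤ m.time + t ∧ (f m).Bounded B ∧ (f m).mem = M') (h : Q () M') :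
    Runs B (modify f : Prog Unit) t M Q := by
  intro m hm hB
  obtain ⟨h1, h2, h3⟩ := hf m hm hB
  exact ⟨(), f m, Part.mem_some _, h1, h2, h3 ▸ h⟩

theorem tick {Q : Unit → Mem → Prop} (h : Q () M) : Runs B tick 1 M Q :=
  modify (fun _ hm hB => ⟨le_rfl, hB, hm⟩) h

theorem op {v : β} {Q : β → Mem → Prop} (h : Q v M) : Runs B (op v) 1 M Q :=
  bind (t₂ := 0) (tick (Q := fun _ M' => M' = M) rfl) (by rintro _ _ rfl; exact pure h)

theorem get_pure {f : Machine → β} {v : β} {Q : β → Mem → Prop}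
    (hf : ∀ m : Machine, m.mem = M → f m = v) (h : Q v M) :
    Runs B ((get : Prog Machine) >>= fun m => Pure.pure (f m)) 0 M Q := by
  intro m hm hB
  refine ⟨v, m, ?_, le_rfl, hB, hm ▸ h⟩
  rw [StateT.run_bind, StateT.run_get, pure_bind, StateT.run_pure, hf m hm]
  exact Part.mem_some _

theorem _root_.WildPal.Machine.Bounded.update_natTop {m : Machine} (hB : m.Bounded B) {i : ℕ}
    (hi : i < B) (a : NArr) (f : NArr → ℕ → ℕ) (s : ℕ) : Machine.Bounded B { m with
      natTop := Function.update m.natTop a (max (m.natTop a) (i + 1)), nat := f, time := s } := by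
  refine ⟨fun a' => ?_, hB.2⟩
  by_cases h : a' = a
  · subst h; simpa using ⟨hB.1 a', hi⟩
  · simpa [h] using hB.1 a'

theorem _root_.WildPal.Machine.Bounded.update_cpxTop {m : Machine} (hB : m.Bounded B) {i : ℕ}
    (hi : i < B) (a : CArr) (f : CArr → ℕ → ℂ) (s : ℕ) : Machine.Bounded B { m with
      cpxTop := Function.update m.cpxTop a (max (m.cpxTop a) (i + 1)), cpx := f, time := s } := by
  refine ⟨hB.1, fun a' => ?_⟩
  by_cases h : a' = a
  · subst h; simpa using ⟨hB.2 a', hi⟩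
  · simpa [h] using hB.2 a'

theorem readN {a : NArr} {i : ℕ} {Q : ℕ → Mem → Prop} (hi : i < B) (h : Q (M.nat a i) M) :
    Runs B (readN a i) 1 M Q := by
  refine bind (t₁ := 1) (t₂ := 0) (tick (Q := fun _ M' => M' = M) rfl) ?_
  rintro _ _ h₀
  rw [h₀]
  refine bind (t₁ := 0) (t₂ := 0) (modify (Q := fun _ M'' => M'' = M) (M' := M)
    (fun m hm hB => ⟨le_rfl, hB.update_natTop hi a _ _, hm⟩) rfl) ?_
  rintro _ _ rfl
  exact get_pure (fun m hm => by subst hm; rfl) h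

theorem readC {a : CArr} {i : ℕ} {Q : ℂ → Mem → Prop} (hi : i < B) (h : Q (M.cpx a i) M) :
    Runs B (readC a i) 1 M Q := by
  refine bind (t₁ := 1) (t₂ := 0) (tick (Q := fun _ M' => M' = M) rfl) ?_
  rintro _ _ h₀
  rw [h₀]
  refine bind (t₁ := 0) (t₂ := 0) (modify (Q := fun _ M'' => M'' = M) (M' := M)
    (fun m hm hB => ⟨le_rfl, hB.update_cpxTop hi a _ _, hm⟩) rfl) ?_
  rintro _ _ rfl
  exact get_pure (fun m hm => by subst hm; rfl) h

theorem writeN {a : NArr} {i v : ℕ} {Q : Unit → Mem → Prop} (hi : i < B)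
    (h : Q () (M.setN a i v)) : Runs B (writeN a i v) 1 M Q := by
  refine bind (t₁ := 1) (t₂ := 0) (tick (Q := fun _ M' => M' = M) rfl) ?_
  rintro _ _ rfl
  exact modify (fun m hm hB => ⟨le_rfl, hB.update_natTop hi a _ _, by subst hm; rfl⟩) h

theorem writeC {a : CArr} {i : ℕ} {v : ℂ} {Q : Unit → Mem → Prop} (hi : i < B)
    (h : Q () (M.setC a i v)) : Runs B (writeC a i v) 1 M Q := by
  refine bind (t₁ := 1) (t₂ := 0) (tick (Q := fun _ M' => M' = M) rfl) ?_
  rintro _ _ rfl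
  exact modify (fun m hm hB => ⟨le_rfl, hB.update_cpxTop hi a _ _, by subst hm; rfl⟩) h

theorem logRound {u : ℝ} {Q : Unit → Mem → Prop}
    (h : Q () { M with rounds := (u, []) :: M.rounds }) : Runs B (logRound u) 0 M Q :=
  modify (fun m hm hB => ⟨le_rfl, hB, by subst hm; rfl⟩) h

theorem logConv {len : ℕ} {Q : Unit → Mem → Prop}
    (h : Q () { M with rounds := pushConv len M.rounds }) : Runs B (logConv len) 0 M Q :=
  modify (fun m hm hB => ⟨le_rfl, hB, by subst hm; rfl⟩) h

/-! ### Sequencing -/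

section seq

variable {Q : γ → Mem → Prop}

/-- In a chain of such rules the memory before each instruction is an explicit term and the time is
accumulated by unification; the claimed bound is checked once, through `mono_time`. -/
theorem bind_same {p : Prog β} {f : β → Prog γ} {v : β} {M' : Mem}
    (hp : Runs B p t₁ M (fun b M'' => b = v ∧ M'' = M'))
    (hf : Runs B (f v) t₂ M' Q) : Runs B (p >>= f) (t₂ + t₁) M Q :=
  (bind hp (by rintro _ _ ⟨rfl, rfl⟩; exact hf)).mono_time (by omega)

theorem op_bind {v : β} {f : β → Prog γ} (h : Runs B (f v) t M Q) :
    Runs B (WildPal.op v >>= f) (t + 1) M Q :=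
  bind_same (op ⟨rfl, rfl⟩) h

theorem pure_bind {v : β} {f : β → Prog γ} (h : Runs B (f v) t M Q) :
    Runs B (Pure.pure v >>= f) t M Q :=
  bind_same (pure ⟨rfl, rfl⟩) h

theorem tick_bind {f : Unit → Prog γ} (h : Runs B (f ()) t M Q) :
    Runs B (WildPal.tick >>= f) (t + 1) M Q :=
  bind_same (tick ⟨rfl, rfl⟩) h

theorem readN_bind {a : NArr} {i : ℕ} {f : ℕ → Prog γ} (hi : i < B)
    (h : Runs B (f (M.nat a i)) t M Q) : Runs B (WildPal.readN a i >>= f) (t + 1) M Q :=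
  bind_same (readN hi ⟨rfl, rfl⟩) h

theorem readC_bind {a : CArr} {i : ℕ} {f : ℂ → Prog γ} (hi : i < B)
    (h : Runs B (f (M.cpx a i)) t M Q) : Runs B (WildPal.readC a i >>= f) (t + 1) M Q :=
  bind_same (readC hi ⟨rfl, rfl⟩) h

theorem writeC_bind {a : CArr} {i : ℕ} {v : ℂ} {f : Unit → Prog γ} (hi : i < B)
    (h : Runs B (f ()) t (M.setC a i v) Q) : Runs B (WildPal.writeC a i v >>= f) (t + 1) M Q :=
  bind_same (writeC hi ⟨rfl, rfl⟩) h

theorem logRound_bind {u : ℝ} {f : Unit → Prog γ}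
    (h : Runs B (f ()) t { M with rounds := (u, []) :: M.rounds } Q) :
    Runs B (WildPal.logRound u >>= f) t M Q :=
  bind_same (logRound ⟨rfl, rfl⟩) h

theorem logConv_bind {len : ℕ} {f : Unit → Prog γ}
    (h : Runs B (f ()) t { M with rounds := pushConv len M.rounds } Q) :
    Runs B (WildPal.logConv len >>= f) t M Q :=
  bind_same (logConv ⟨rfl, rfl⟩) h

theorem ite {c : Prop} [Decidable c] {p q : Prog γ} (hp : c → Runs B p t₁ M Q)
    (hq : ¬ c → Runs B q t₂ M Q) : Runs B (if c then p else q) (max t₁ t₂) M Q := by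
  split_ifs with h
  · exact (hp h).mono_time (le_max_left _ _)
  · exact (hq h).mono_time (le_max_right _ _)

end seq

/-! ### Loops -/

theorem forLoop {body : ℕ → Prog Unit} {I : ℕ → Mem → Prop} {k : ℕ}
    (h0 : I 0 M)
    (hstep : ∀ i < k, ∀ M, I i M → Runs B (body i) t M (fun _ M' => I (i + 1) M')) :
    Runs B (forLoop k body) (k * (t + 2) + 1) M (fun _ M' => I k M') := by
  induction k with
  | zero => exact (tick h0).mono_time (by omega)
  | succ k ih =>
    have hk := ih fun i hi => hstep i (by omega)
    refine mono_time ?_ (bind hk fun _ M₁ h₁ => bind (hstep k (by omega) M₁ h₁) fun _ M₂ h₂ =>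
      tick_bind (tick h₂))
    rw [Nat.succ_mul]; omega

/-- `k` bounds the passes still to come: a successful test must show that it is positive, and the
body must lower it. Termination follows by induction on `k`, unfolding the fixpoint once per pass.
-/
theorem whileLoop {σ : Type} {cond : σ → Prog Bool} {body : σ → Prog σ}
    {I : ℕ → σ → Mem → Prop} {Q : σ → Mem → Prop} {k : ℕ} {s : σ}
    (h0 : I k s M)
    (hstep : ∀ k s M, I k s M → Runs B (cond s) t₁ M (fun b M' =>
      if b then ∃ k', k = k' + 1 ∧ Runs B (body s) t₂ M' (fun s' M'' => I k' s' M'')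
      else Q s M')) :
    Runs B (whileLoop cond body s) (k * (t₁ + t₂ + 1) + (t₁ + 1)) M Q := by
  induction k generalizing s M with
  | zero =>
    intro m hm hB
    obtain ⟨b, m', h1, h2, h3, h4⟩ := hstep _ _ _ h0 m hm hB
    cases b with
    | true => obtain ⟨k', hk', -⟩ := h4; omega
    | false =>
      refine ⟨s, { m' with time := m'.time + 1 }, ?_, ?_, h3, h4⟩
      · refine PFun.mem_fix_iff.2 (Or.inl ?_)
        refine (Part.mem_map_iff _).2 ⟨((false, s), { m' with time := m'.time + 1 }), ?_, rfl⟩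
        rw [StateT.run_bind]
        exact Part.mem_bind h1 (Part.mem_bind (Part.mem_some _) (Part.mem_some _))
      · simp; omega
  | succ k ih =>
    intro m hm hB
    obtain ⟨b, m', h1, h2, h3, h4⟩ := hstep _ _ _ h0 m hm hB
    cases b with
    | false =>
      refine ⟨s, { m' with time := m'.time + 1 }, ?_, ?_, h3, h4⟩
      · refine PFun.mem_fix_iff.2 (Or.inl ?_)
        refine (Part.mem_map_iff _).2 ⟨((false, s), { m' with time := m'.time + 1 }), ?_, rfl⟩
        rw [StateT.run_bind]
        exact Part.mem_bind h1 (Part.mem_bind (Part.mem_some _) (Part.mem_some _))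
      · rw [Nat.succ_mul]; simp; omega
    | true =>
      obtain ⟨k', hk', hb⟩ := h4
      obtain rfl : k = k' := by omega
      obtain ⟨s', m'', b1, b2, b3, b4⟩ := hb { m' with time := m'.time + 1 } rfl h3
      obtain ⟨c, m3, c1, c2, c3, c4⟩ := ih b4 m'' rfl b3
      refine ⟨c, m3, ?_, ?_, c3, c4⟩
      · refine PFun.mem_fix_iff.2 (Or.inr ⟨(s', m''), ?_, c1⟩)
        refine (Part.mem_map_iff _).2 ⟨((true, s'), m''), ?_, rfl⟩
        rw [StateT.run_bind]
        refine Part.mem_bind h1 ?_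
        rw [StateT.run_bind]
        refine Part.mem_bind (Part.mem_some _) ?_
        simp only [↓reduceIte]
        rw [StateT.run_bind]
        exact Part.mem_bind b1 (Part.mem_some _)
      · rw [Nat.succ_mul]; simp at b2; omega

end Runs

end WildPal

namespace WildPal

open Finset

/-! ## The Fourier transform -/

/-- `M'` differs from `M` at most in the arrays of complex numbers in `A`. -/
structure CFrame (A : Set CArr) (M M' : Mem) : Prop where
  nat : M'.nat = M.nat
  rounds : M'.rounds = M.rounds
  cpx : ∀ a ∉ A, M'.cpx a = M.cpx a

theorem CFrame.refl (A : Set CArr) (M : Mem) : CFrame A M M := ⟨rfl, rfl, fun _ _ => rfl⟩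

theorem CFrame.trans {A : Set CArr} {M₁ M₂ M₃ : Mem} (h₁ : CFrame A M₁ M₂) (h₂ : CFrame A M₂ M₃) :
    CFrame A M₁ M₃ :=
  ⟨h₂.nat.trans h₁.nat, h₂.rounds.trans h₁.rounds,
    fun a ha => (h₂.cpx a ha).trans (h₁.cpx a ha)⟩

theorem CFrame.mono {A A' : Set CArr} {M M' : Mem} (h : CFrame A M M') (hA : A ⊆ A') :
    CFrame A' M M' :=
  ⟨h.nat, h.rounds, fun a ha => h.cpx a fun h' => ha (hA h')⟩

theorem Mem.setC_cpx_self (M : Mem) (a : CArr) (i : ℕ) (v : ℂ) (j : ℕ) :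
    (M.setC a i v).cpx a j = if j = i then v else M.cpx a j := by
  simp [Mem.setC, Function.update_apply]

theorem Mem.setC_cpx_of_ne (M : Mem) {a a' : CArr} (h : a' ≠ a) (i : ℕ) (v : ℂ) :
    (M.setC a i v).cpx a' = M.cpx a' := by
  simp [Mem.setC, h]

theorem CFrame.setC {A : Set CArr} {M M' : Mem} (h : CFrame A M M') {a : CArr} (ha : a ∈ A)
    (i : ℕ) (v : ℂ) : CFrame A M (M'.setC a i v) :=
  ⟨h.nat, h.rounds, fun a' ha' => by
    rw [Mem.setC_cpx_of_ne _ (by rintro rfl; exact ha' ha), h.cpx a' ha']⟩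

theorem runs_fillRoots {B N : ℕ} (hN : 1 ≤ N) (hB : N ≤ B) (ω : ℂ) (M : Mem) :
    Runs B (fillRoots N ω) (6 * N) M (fun _ M' => CFrame {.root} M M' ∧
      ∀ k < N, M'.cpx .root k = ω ^ k) := by
  refine Runs.mono_time ?_ <| .writeC_bind (by omega) <| Runs.mono (.forLoop (t := 4)
    (I := fun i M' => CFrame {.root} M M' ∧ ∀ k ≤ i, M'.cpx .root k = ω ^ k) ?_ ?_) ?_
  · omega
  · refine ⟨(CFrame.refl _ _).setC (by simp) _ _, fun k hk => ?_⟩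
    obtain rfl : k = 0 := by omega
    simp [Mem.setC_cpx_self]
  · rintro i hi M' ⟨hF, hM'⟩
    refine .readC_bind (by omega) <| .op_bind <| .op_bind <| .writeC (by omega) ?_
    refine ⟨hF.setC (by simp) _ _, fun k hk => ?_⟩
    rw [Mem.setC_cpx_self]
    split_ifs with h
    · rw [hM' i le_rfl, h, pow_succ]
    · exact hM' k (by omega)
  · rintro _ M' ⟨hF, hM'⟩
    exact ⟨hF, fun k hk => hM' k (by omega)⟩

/-- One pass of the main loop of `fft`. -/
def fftStage (N h : ℕ) (b : CArr) (s : ℕ) : Prog ℕ := do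
  forLoop h fun i => do
    let q ← op (i % s)
    let k ← op (i - q)
    let j ← op (i + h)
    let x ← readC b i
    let y ← readC b j
    let w ← readC .root k
    let d ← op (x + y)
    let e ← op (x - y)
    let e ← op (e * w)
    let o ← op (i + k)
    writeC .tmp o d
    let o ← op (o + s)
    writeC .tmp o e
  forLoop N fun i => do
    let x ← readC .tmp i
    writeC b i x
  op (2 * s)

theorem fft_eq (N : ℕ) (b : CArr) : fft N b = (do
    let h ← op (N / 2)
    let _ ← whileLoop (fun s : ℕ => op (decide (s < N))) (fftStage N h b) 1
    pure ()) := rfl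

/-- With `i = s * p + q` and `q = i % s`, the addresses `i + (i - q)` and `i + (i - q) + s` are `2 *
s * p + q` and `2 * s * p + (q + s)`. -/
theorem runs_fftStage {B N h s L : ℕ} {b : CArr} (hb : b ≠ .tmp) (hs : 0 < s)
    (hh : h = s * L) (hN : N = 2 * h) (hB : N ≤ B) (M : Mem) :
    Runs B (fftStage N h b s) (12 * N + 3) M (fun s' M' => s' = 2 * s ∧ CFrame {b, .tmp} M M' ∧
      ∀ p < L, ∀ q < s,
        M'.cpx b (2 * s * p + q) = M.cpx b (s * p + q) + M.cpx b (s * p + q + h) ∧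
        M'.cpx b (2 * s * p + (q + s)) =
          (M.cpx b (s * p + q) - M.cpx b (s * p + q + h)) * M.cpx .root (s * p)) := by
  refine Runs.mono_time ?_ <| .bind (.forLoop (t := 13)
    (I := fun i M' => CFrame {.tmp} M M' ∧ ∀ i' < i,
      M'.cpx .tmp (i' + (i' - i' % s)) = M.cpx b i' + M.cpx b (i' + h) ∧
      M'.cpx .tmp (i' + (i' - i' % s) + s) =
        (M.cpx b i' - M.cpx b (i' + h)) * M.cpx .root (i' - i' % s)) ?_ ?_) fun _ M₁ h₁ =>
    .bind (.forLoop (t := 2) (I := fun i M' => CFrame {b} M₁ M' ∧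
      ∀ j < i, M'.cpx b j = M₁.cpx .tmp j) ?_ ?_) fun _ M₂ h₂ => .op ?_
  · omega
  · exact ⟨CFrame.refl _ _, fun _ h => absurd h (by omega)⟩
  · rintro i hi M' ⟨hF, hM'⟩
    have hd : ∀ i, i % s + s * (i / s) = i := fun i => Nat.mod_add_div i s
    have hlt : ∀ i, i % s < s := fun i => Nat.mod_lt i hs
    have hi1 : s * (i / s) + s ≤ h := by
      rw [← Nat.mul_succ, hh]
      exact Nat.mul_le_mul_left _ (Nat.div_lt_of_lt_mul (hh ▸ hi))
    have hi2 := hd i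
    have hi3 := hlt i
    refine .op_bind <| .op_bind <| .op_bind <| .readC_bind (by omega) <| .readC_bind (by omega) <|
      .readC_bind (by omega) <| .op_bind <| .op_bind <| .op_bind <| .op_bind <|
      .writeC_bind (by omega) <| .op_bind <| .writeC (by omega) ?_
    refine ⟨(hF.setC (by simp) _ _).setC (by simp) _ _, fun i' hi' => ?_⟩
    simp only [Mem.setC_cpx_self]
    rw [hF.cpx b (by simpa using hb), hF.cpx .root (by simp)]
    rcases Nat.lt_succ_iff_lt_or_eq.1 hi' with h' | rfl
    · have hi4 := hd i'
      have hi5 := hlt i'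
      -- Two indices lie in the same block of length `s` or in separated blocks; either way their
      -- target addresses differ, so earlier results survive.
      have h6 : s * (i' / s) = s * (i / s) ∨ s * (i' / s) + s ≤ s * (i / s) := by
        rcases (Nat.div_le_div_right (c := s) h'.le).eq_or_lt with h | h
        · exact Or.inl (by rw [h])
        · exact Or.inr (by rw [← Nat.mul_succ]; exact Nat.mul_le_mul_left _ h)
      obtain ⟨e1, e2⟩ := hM' i' h'
      rw [if_neg (by omega), if_neg (by omega), if_neg (by omega), if_neg (by omega)]
      exact ⟨e1, e2⟩
    · rw [if_neg (by omega), if_pos rfl, if_pos rfl]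
      exact ⟨rfl, rfl⟩
  · exact ⟨CFrame.refl _ _, fun _ h => absurd h (by omega)⟩
  · rintro i hi M' ⟨hF, hM'⟩
    refine .readC_bind (by omega) <| .writeC (by omega) ?_
    refine ⟨hF.setC (by simp) _ _, fun j hj => ?_⟩
    rw [Mem.setC_cpx_self, hF.cpx .tmp (by simpa using hb.symm)]
    split_ifs with h
    · rw [h]
    · exact hM' j (by omega)
  · obtain ⟨hF₁, h₁⟩ := h₁
    obtain ⟨hF₂, h₂⟩ := h₂
    refine ⟨rfl, (hF₁.mono (by simp)).trans (hF₂.mono (by simp)), fun p hp q hq => ?_⟩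
    have hle : s * p + s ≤ h := by
      rw [← Nat.mul_succ, hh]
      exact Nat.mul_le_mul_left _ hp
    have hmod : (s * p + q) % s = q := by
      rw [Nat.mul_add_mod, Nat.mod_eq_of_lt hq]
    obtain ⟨e1, e2⟩ := h₁ (s * p + q) (by omega)
    rw [hmod, Nat.add_sub_cancel] at e1 e2
    rw [h₂ _ (by rw [mul_assoc]; omega), h₂ _ (by rw [mul_assoc]; omega), ← e1, ← e2]
    constructor <;> congr 1 <;> ring

/-- Decimation in frequency. Each residue class modulo `s` holds a sequence whose transform is the
part of `F` in that class. Since `ω ^ (s * L) = -1`, shifting `p` by `L` multiplies the exponential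
by `(-1) ^ f`: even `f` see sums, odd `f` see twisted differences. Storing these in the classes `q`
and `q + s` modulo `2 * s` yields natural order without bit reversal. -/
theorem fft_step {s L : ℕ} {ω : ℂ} (hω : ω ^ (s * L) = -1) {X X' F : ℕ → ℂ}
    (hX : ∀ q < s, ∀ f < 2 * L, ∑ p ∈ range (2 * L), X (s * p + q) * ω ^ (s * p * f) = F (s * f + q))
    (hX' : ∀ p < L, ∀ q < s,
        X' (2 * s * p + q) = X (s * p + q) + X (s * p + q + s * L) ∧
        X' (2 * s * p + (q + s)) =
          (X (s * p + q) - X (s * p + q + s * L)) * ω ^ (s * p)) :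
    ∀ q < 2 * s, ∀ f < L,
      ∑ p ∈ range L, X' (2 * s * p + q) * ω ^ (2 * s * p * f) = F (2 * s * f + q) := by
  have key : ∀ q < s, ∀ f < 2 * L, ∑ p ∈ range L, (X (s * p + q) + (-1) ^ f * X (s * p + q + s * L)) *
      ω ^ (s * p * f) = F (s * f + q) := by
    intro q hq f hf
    rw [← hX q hq f hf, two_mul, Finset.sum_range_add, ← Finset.sum_add_distrib]
    refine Finset.sum_congr rfl fun p _ => ?_
    have e1 : s * (L + p) + q = s * p + q + s * L := by ring
    have e2 : ω ^ (s * (L + p) * f) = (-1) ^ f * ω ^ (s * p * f) := by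
      rw [← hω, ← pow_mul, ← pow_add]; congr 1; ring
    rw [e1, e2]; ring
  intro q hq f hf
  rcases lt_or_ge q s with h | h
  · have e : 2 * s * f + q = s * (2 * f) + q := by ring
    rw [e, ← key q h (2 * f) (by omega)]
    refine Finset.sum_congr rfl fun p hp => ?_
    rw [(hX' p (by simpa using hp) q h).1, pow_mul (-1 : ℂ) 2 f]
    have e : 2 * s * p * f = s * p * (2 * f) := by ring
    rw [e]; simp
  · obtain ⟨q, rfl⟩ := Nat.exists_eq_add_of_le' h
    have e : 2 * s * f + (q + s) = s * (2 * f + 1) + q := by ring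
    rw [e, ← key q (by omega) (2 * f + 1) (by omega)]
    refine Finset.sum_congr rfl fun p hp => ?_
    rw [(hX' p (by simpa using hp) q (by omega)).2, pow_succ, pow_mul (-1 : ℂ) 2 f, mul_assoc _ (ω ^ _),
      ← pow_add]
    have e : s * p + 2 * s * p * f = s * p * (2 * f + 1) := by ring
    rw [e, neg_one_sq, one_pow]; ring

theorem runs_fft {B K : ℕ} {b : CArr} (hb : b ≠ .tmp) (hb' : b ≠ .root) (hB : 2 ^ K ≤ B) (M : Mem)
    {ω : ℂ} (hω : 0 < K → ω ^ 2 ^ (K - 1) = -1)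
    (hr : ∀ k < 2 ^ K, M.cpx .root k = ω ^ k) :
    Runs B (fft (2 ^ K) b) (17 * 2 ^ K * (K + 1)) M (fun _ M' => CFrame {b, .tmp} M M' ∧
      ∀ k < 2 ^ K, M'.cpx b k = ∑ j ∈ range (2 ^ K), M.cpx b j * ω ^ (j * k)) := by
  rw [fft_eq]
  -- For `j = 0` the invariant is the definition of the transform; for `j = K` every class is a
  -- single entry, which is the transform itself.
  refine Runs.mono_time ?_ <| .op_bind <| .bind (.whileLoop (k := K) (t₁ := 1) (t₂ := 12 * 2 ^ K + 3)
    (I := fun k s M' => ∃ j, s = 2 ^ j ∧ j + k = K ∧ CFrame {b, .tmp} M M' ∧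
      ∀ q < 2 ^ j, ∀ f < 2 ^ (K - j), ∑ p ∈ range (2 ^ (K - j)), M'.cpx b (2 ^ j * p + q) *
        ω ^ (2 ^ j * p * f) = ∑ i ∈ range (2 ^ K), M.cpx b i * ω ^ (i * (2 ^ j * f + q)))
    (Q := fun _ M' => CFrame {b, .tmp} M M' ∧
      ∀ k < 2 ^ K, M'.cpx b k = ∑ j ∈ range (2 ^ K), M.cpx b j * ω ^ (j * k)) ?_ ?_)
    fun _ _ h => .pure h
  · have : 1 ≤ 2 ^ K := Nat.one_le_two_pow
    nlinarith
  · refine ⟨0, by simp, by simp, CFrame.refl _ _, fun q hq f hf => ?_⟩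
    obtain rfl : q = 0 := by simpa using hq
    simp
  · rintro k s M' ⟨j, rfl, hj, hF, hM'⟩
    refine .op ?_
    rcases k with _ | k
    · obtain rfl : j = K := by omega
      simp only [lt_self_iff_false, decide_false]
      refine ⟨hF, fun k hk => ?_⟩
      have := hM' k hk 0 (by simp)
      simpa using this
    · have hlt : (2 : ℕ) ^ j < 2 ^ K := Nat.pow_lt_pow_right (by simp) (by omega)
      have hKj : K - j = k + 1 := by omega
      simp only [hlt, decide_true, if_true]
      refine ⟨k, rfl, (runs_fftStage (L := 2 ^ k) (h := 2 ^ K / 2) hb (by positivity) ?_ ?_ hB M').mono ?_⟩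
      · rw [← hj, ← pow_add, ← Nat.add_assoc, pow_succ]; simp
      · rw [← hj, ← Nat.add_assoc, pow_succ]; omega
      · rintro s' M'' ⟨rfl, hF', hM''⟩
        have hh : 2 ^ K / 2 = 2 ^ j * 2 ^ k := by
          rw [← hj, ← pow_add, ← Nat.add_assoc, pow_succ]; simp
        refine ⟨j + 1, by ring, by omega, hF.trans hF', ?_⟩
        have hKj' : K - (j + 1) = k := by omega
        rw [hKj, pow_succ'] at hM'
        have := fft_step (s := 2 ^ j) (L := 2 ^ k) (ω := ω) (X' := M''.cpx b)
          (F := fun k => ∑ i ∈ range (2 ^ K), M.cpx b i * ω ^ (i * k))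
          (by rw [← hω (by omega), ← pow_add, ← hj]; rfl) hM' (fun p hp q hq => by
            rw [← hh]
            have := hM'' p hp q hq
            rwa [hF.cpx .root (by simpa using hb'.symm), hr] at this
            have h1 : 2 ^ j * p < 2 ^ j * 2 ^ k := Nat.mul_lt_mul_of_pos_left hp (by positivity)
            have h2 : 2 ^ K / 2 ≤ 2 ^ K := Nat.div_le_self _ _
            omega)
        rw [hKj', pow_succ']
        exact this

end WildPal

namespace WildPal

open Finset

/-! ## The matching convolution program -/

/-- Two character codes match. -/
def MatchN (a b : ℕ) : Prop := a = 0 ∨ b = 0 ∨ a = b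

theorem MatchN.symm {a b : ℕ} (h : MatchN a b) : MatchN b a := by
  unfold MatchN at *; omega

/-- The point at angle `2 * π / 2 ^ K` is a primitive root of unity, and its conjugate the inverse. -/
theorem root_spec {K : ℕ} {θ : ℝ} (hθ : θ = 2 * Real.pi / (2 ^ K : ℕ)) :
    IsPrimitiveRoot (⟨Real.cos θ, Real.sin θ⟩ : ℂ) (2 ^ K) ∧
      (⟨Real.cos θ, Real.sin θ⟩ : ℂ) * ⟨Real.cos θ, -Real.sin θ⟩ = 1 := by
  constructor
  · have h := Complex.isPrimitiveRoot_exp (2 ^ K) (by positivity)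
    have e : (2 * Real.pi * Complex.I / (2 ^ K : ℕ) : ℂ) = (θ : ℂ) * Complex.I := by
      rw [hθ]; push_cast; ring
    rw [e] at h
    convert h using 1
    apply Complex.ext
    · simp [Complex.exp_ofReal_mul_I_re]
    · simp [Complex.exp_ofReal_mul_I_im]
  · have := Real.cos_sq_add_sin_sq θ
    apply Complex.ext
    · simp; nlinarith
    · simp; ring

theorem pow_half_eq_neg_one {ω : ℂ} {K : ℕ} (hω : IsPrimitiveRoot ω (2 ^ K)) (hK : 0 < K) :
    ω ^ 2 ^ (K - 1) = -1 := by
  obtain ⟨k, rfl⟩ : ∃ k, K = k + 1 := ⟨K - 1, by omega⟩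
  have h1 : ω ^ 2 ^ k * ω ^ 2 ^ k = 1 := by rw [← pow_add, ← hω.pow_eq_one]; congr 1; ring
  rcases mul_self_eq_one_iff.1 h1 with h | h
  · exact absurd h (hω.pow_ne_one_of_pos_of_lt (by positivity)
      (Nat.pow_lt_pow_right (by simp) (by simp)))
  · exact h

/-- Orthogonality: a geometric sum whose ratio `ω ^ m * ω' ^ i` is an `N`-th root of unity, equal to
`1` only if `m = i`. -/
theorem sum_pow_root {ω ω' : ℂ} {N : ℕ} (hω : IsPrimitiveRoot ω N) (h : ω * ω' = 1) {m i : ℕ}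
    (hm : m < N) (hi : i < N) :
    ∑ k ∈ range N, ω ^ (m * k) * ω' ^ (k * i) = if m = i then (N : ℂ) else 0 := by
  have e : ∀ k, ω ^ (m * k) * ω' ^ (k * i) = (ω ^ m * ω' ^ i) ^ k := fun k => by
    rw [mul_pow, ← pow_mul, ← pow_mul, mul_comm i k]
  simp only [e]
  split_ifs with hmi
  · rw [hmi, ← mul_pow, h]; simp
  · have hne : ω ^ m * ω' ^ i - 1 ≠ 0 := by
      intro h0
      apply hmi
      refine hω.pow_inj hm hi ?_
      calc ω ^ m = ω ^ m * ω' ^ i * ω ^ i := by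
            rw [mul_assoc, ← mul_pow, mul_comm ω', h]; simp
        _ = ω ^ i := by rw [sub_eq_zero.1 h0, one_mul]
    have hN : (ω ^ m * ω' ^ i) ^ N = 1 := by
      have h1 : ω' ^ N = 1 := by
        have := congrArg (· ^ N) h
        simpa [mul_pow, hω.pow_eq_one] using this
      rw [mul_pow, ← pow_mul, ← pow_mul, mul_comm m, mul_comm i, pow_mul, pow_mul, hω.pow_eq_one, h1]
      simp
    have := mul_geom_sum (ω ^ m * ω' ^ i) N
    rw [hN, sub_self] at this
    exact (mul_eq_zero.1 this).resolve_left hne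

/-- Products of transforms give cyclic convolution; `2 * len ≤ N` keeps `a + b` below `N`, so
nothing wraps around. The factor `N` is the missing normalization. -/
theorem sum_fourier_mul {ω ω' : ℂ} {N len : ℕ} (hω : IsPrimitiveRoot ω N) (h : ω * ω' = 1)
    (hN : 2 * len ≤ N) (f g : ℕ → ℂ) {i : ℕ} (hi : i < N) :
    ∑ k ∈ range N, ((∑ a ∈ range len, f a * ω ^ (a * k)) * ∑ b ∈ range len, g b * ω ^ (b * k)) *
      ω' ^ (k * i) =
    N * ∑ a ∈ range len, ∑ b ∈ range len, if a + b = i then f a * g b else 0 := by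
  simp only [Finset.sum_mul_sum]
  simp only [Finset.sum_mul]
  rw [Finset.sum_comm, Finset.mul_sum]
  refine Finset.sum_congr rfl fun a ha => ?_
  rw [Finset.sum_comm, Finset.mul_sum]
  refine Finset.sum_congr rfl fun b hb => ?_
  simp only [mem_range] at ha hb
  calc _ = f a * g b * ∑ k ∈ range N, ω ^ ((a + b) * k) * ω' ^ (k * i) := by
        rw [Finset.mul_sum]
        refine Finset.sum_congr rfl fun k _ => ?_
        rw [add_mul, pow_add]; ring
    _ = _ := by
        rw [sum_pow_root hω h (by omega) hi]
        split_ifs <;> ring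

/-- Adding the sum with `a` and `b` exchanged gives a sum of the nonnegative reals `x a * x b * (x a
- x b) ^ 2`, so no cancellation can hide a mismatch. -/
theorem sum_mismatch_eq_zero_iff (x : ℕ → ℕ) (len i : ℕ) :
    (∑ a ∈ range len, ∑ b ∈ range len, if a + b = i then
      ((x a : ℂ) ^ 3 * x b - (x a : ℂ) ^ 2 * (x b : ℂ) ^ 2) else 0) = 0 ↔
    ∀ a b, a < len → b < len → a + b = i → MatchN (x a) (x b) := by
  set E := ∑ a ∈ range len, ∑ b ∈ range len, if a + b = i then
      ((x a : ℂ) ^ 3 * x b - (x a : ℂ) ^ 2 * (x b : ℂ) ^ 2) else 0 with hE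
  have h2 : 2 * E = ((∑ a ∈ range len, ∑ b ∈ range len, if a + b = i then
      (x a : ℝ) * x b * ((x a : ℝ) - x b) ^ 2 else 0 : ℝ) : ℂ) := by
    have hE' : E = ∑ a ∈ range len, ∑ b ∈ range len, if a + b = i then
      ((x b : ℂ) ^ 3 * x a - (x b : ℂ) ^ 2 * (x a : ℂ) ^ 2) else 0 := by
      rw [hE, Finset.sum_comm]
      simp only [add_comm]
    rw [two_mul]
    nth_rewrite 2 [hE']
    rw [hE, ← Finset.sum_add_distrib]
    push_cast
    refine Finset.sum_congr rfl fun a _ => ?_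
    rw [← Finset.sum_add_distrib]
    refine Finset.sum_congr rfl fun b _ => ?_
    split_ifs
    · push_cast; ring
    · simp
  have h3 : ∀ a b, 0 ≤ (if a + b = i then (x a : ℝ) * x b * ((x a : ℝ) - x b) ^ 2 else 0) := by
    intro a b; split_ifs <;> positivity
  have h4 : E = 0 ↔ 2 * E = 0 := by simp
  rw [h4, h2, Complex.ofReal_eq_zero,
    Finset.sum_eq_zero_iff_of_nonneg fun a _ => Finset.sum_nonneg fun b _ => h3 a b]
  have h5 : ∀ a b : ℕ, (a : ℝ) * b * ((a : ℝ) - b) ^ 2 = 0 ↔ MatchN a b := by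
    intro a b
    simp [MatchN, sub_eq_zero, or_assoc]
  constructor
  · intro H a b ha hb hab
    have := (Finset.sum_eq_zero_iff_of_nonneg fun b _ => h3 a b).1 (H a (by simpa)) b (by simpa)
    rw [if_pos hab] at this
    exact (h5 _ _).1 this
  · intro H a ha
    refine Finset.sum_eq_zero fun b hb => ?_
    split_ifs with hab
    · exact (h5 _ _).2 (H a b (by simpa using ha) (by simpa using hb) hab)
    · rfl

theorem Mem.setN_nat_self (M : Mem) (a : NArr) (i v j : ℕ) :
    (M.setN a i v).nat a j = if j = i then v else M.nat a j := by
  simp [Mem.setN, Function.update_apply]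

theorem Mem.setN_nat_of_ne (M : Mem) {a a' : NArr} (h : a' ≠ a) (i v : ℕ) :
    (M.setN a i v).nat a' = M.nat a' := by
  simp [Mem.setN, h]

theorem sum_range_ite_zero {N len : ℕ} (h : len ≤ N) (f g : ℕ → ℂ) :
    ∑ j ∈ range N, (if j < len then f j else 0) * g j = ∑ j ∈ range len, f j * g j := by
  rw [← Finset.sum_subset (Finset.range_subset_range.2 h)]
  · exact Finset.sum_congr rfl fun j hj => by rw [if_pos (by simpa using hj)]
  · intro j _ hj
    rw [if_neg (by simpa using hj), zero_mul]

/-- The alignment of the characters `x l, …, x (l + len - 1)` with their reverse in which the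
offsets add up to `i` has no mismatch. -/
def SelfMatch (x : ℕ → ℕ) (l len i : ℕ) : Prop :=
  ∀ a b, a < len → b < len → a + b = i → MatchN (x (l + a)) (x (l + b))

open Classical in
theorem runs_mconvProg {B l r K : ℕ} (hK : K = Nat.clog 2 (2 * (r - l + 1))) (hl : l ≤ r)
    (hr : r < B) (hB : 2 ^ K ≤ B) (M : Mem) :
    Runs B (mconvProg l r) (150 * 2 ^ K * (K + 1)) M (fun _ M' =>
      M'.rounds = pushConv (r - l + 1) M.rounds ∧ (∀ a ≠ .mat, M'.nat a = M.nat a) ∧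
      ∀ i < 2 * (r - l + 1) - 1, M'.nat .mat (i + 1) =
        if SelfMatch (M.nat .str) l (r - l + 1) i then 1 else 0) := by
  set len := r - l + 1 with hlen
  have hN : 2 * len ≤ 2 ^ K := hK ▸ Nat.le_pow_clog (by simp) _
  have hK0 : 0 < K := hK ▸ Nat.clog_pos (by simp) (by omega)
  set x : ℕ → ℕ := fun j => M.nat .str (l + j) with hx
  obtain ⟨hω, hω'⟩ := root_spec (K := K) rfl
  set θ : ℝ := 2 * Real.pi / (2 ^ K : ℕ) with hθ
  set ω : ℂ := ⟨Real.cos θ, Real.sin θ⟩ with hωdef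
  set ω' : ℂ := ⟨Real.cos θ, -Real.sin θ⟩ with hωdef'
  have hωinv : IsPrimitiveRoot ω' (2 ^ K) := by
    rw [eq_inv_of_mul_eq_one_right hω']
    exact hω.inv
  set D : ℕ → ℂ := fun k =>
    (∑ a ∈ range len, (x a : ℂ) ^ 3 * ω ^ (a * k)) * (∑ a ∈ range len, (x a : ℂ) * ω ^ (a * k)) -
    (∑ a ∈ range len, (x a : ℂ) ^ 2 * ω ^ (a * k)) * (∑ a ∈ range len, (x a : ℂ) ^ 2 * ω ^ (a * k))
    with hD
  -- The mathematical content of the subroutine: the inverse transform of `D` is `2 ^ K` times the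
  -- mismatch sum. The rest checks that the program computes it.
  have hfinal : ∀ i < 2 ^ K, (∑ k ∈ range (2 ^ K), D k * ω' ^ (k * i) = 0 ↔
      SelfMatch (M.nat .str) l len i) := by
    intro i hi
    rw [SelfMatch, ← sum_mismatch_eq_zero_iff x len i]
    simp only [hD, sub_mul, Finset.sum_sub_distrib]
    rw [sum_fourier_mul hω hω' hN (fun a => (x a : ℂ) ^ 3) (fun a => (x a : ℂ)) hi,
      sum_fourier_mul hω hω' hN (fun a => (x a : ℂ) ^ 2) (fun a => (x a : ℂ) ^ 2) hi, ← mul_sub,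
      mul_eq_zero, or_iff_right (by simp), ← Finset.sum_sub_distrib]
    simp only [← Finset.sum_sub_distrib]
    refine iff_of_eq (congrArg (· = 0) ?_)
    refine Finset.sum_congr rfl fun a _ => Finset.sum_congr rfl fun b _ => ?_
    split_ifs
    · ring
    · simp
  refine Runs.mono_time ?_ <| .op_bind <| .op_bind <| .logConv_bind <| .op_bind <|
    .bind (t₂ := 140 * 2 ^ K * (K + 1)) (.whileLoop (k := K) (t₁ := 1) (t₂ := 1)
      (I := fun k s M' => ∃ j, s = 2 ^ j ∧ j + k = K ∧
        M' = { M with rounds := pushConv len M.rounds })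
      (Q := fun s M' => s = 2 ^ K ∧ M' = { M with rounds := pushConv len M.rounds }) ?_ ?_) ?_
  · have h1 : 1 ≤ 2 ^ K := Nat.one_le_two_pow
    nlinarith
  · exact ⟨0, by simp, by simp, rfl⟩
  · rintro k s M' ⟨j, rfl, hj, rfl⟩
    refine .op ?_
    by_cases h : 2 ^ j < 2 * len
    · have hjK : j < K := hK ▸ (Nat.lt_clog_iff_pow_lt (by simp)).2 h
      simp only [← hlen, h, decide_true, if_true]
      exact ⟨k - 1, by omega, .op ⟨j + 1, by ring, by omega, rfl⟩⟩
    · have hjK : K ≤ j := hK ▸ (Nat.clog_le_iff_le_pow (by simp)).2 (not_lt.1 h)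
      obtain rfl : j = K := by omega
      simp [← hlen, h]
  · rintro _ M₀ ⟨rfl, hM₀⟩
    have hM₀n : M₀.nat = M.nat := by rw [hM₀]
    have hM₀r : M₀.rounds = pushConv len M.rounds := by rw [hM₀]
    simp only [← hlen]
    refine Runs.mono_time ?_ <| .bind (.forLoop (t := 7) (I := fun i M' => CFrame {.x1, .x2, .x3} M₀ M' ∧ ∀ j < i,
      M'.cpx .x1 j = x j ∧ M'.cpx .x2 j = (x j : ℂ) ^ 2 ∧ M'.cpx .x3 j = (x j : ℂ) ^ 3) ?_ ?_)
      fun _ M₁ ⟨hF₁, h₁⟩ => .op_bind <|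
      .bind (.forLoop (t := 4) (I := fun i M' => CFrame {.x1, .x2, .x3} M₀ M' ∧ ∀ j < len + i,
        M'.cpx .x1 j = (if j < len then (x j : ℂ) else 0) ∧
        M'.cpx .x2 j = (if j < len then (x j : ℂ) ^ 2 else 0) ∧
        M'.cpx .x3 j = (if j < len then (x j : ℂ) ^ 3 else 0)) ?_ ?_)
      fun _ M₂ ⟨hF₂, h₂⟩ => .op_bind <| .op_bind <| .op_bind <|
      .bind (runs_fillRoots Nat.one_le_two_pow hB ω M₂) fun _ M₃ ⟨hF₃, h₃⟩ =>
      .bind (runs_fft (by simp) (by simp) hB M₃ (pow_half_eq_neg_one hω) h₃)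
      fun _ M₄ ⟨hF₄, h₄⟩ =>
      .bind (runs_fft (by simp) (by simp) hB M₄ (pow_half_eq_neg_one hω)
        fun k hk => by rw [hF₄.cpx _ (by simp), h₃ k hk])
      fun _ M₅ ⟨hF₅, h₅⟩ =>
      .bind (runs_fft (by simp) (by simp) hB M₅ (pow_half_eq_neg_one hω)
        fun k hk => by rw [hF₅.cpx _ (by simp), hF₄.cpx _ (by simp), h₃ k hk])
      fun _ M₆ ⟨hF₆, h₆⟩ =>
      -- `x1` is overwritten in place, so the invariant must describe both the processed and the
      -- untouched entries.
      .bind (.forLoop (t := 7) (I := fun i M' => CFrame {.x1} M₆ M' ∧ ∀ j < 2 ^ K,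
        M'.cpx .x1 j = if j < i then D j else M₆.cpx .x1 j) ?_ ?_)
      fun _ M₇ ⟨hF₇, h₇⟩ => .op_bind <|
      .bind (runs_fillRoots Nat.one_le_two_pow hB ω' M₇) fun _ M₈ ⟨hF₈, h₈⟩ =>
      .bind (runs_fft (by simp) (by simp) hB M₈ (pow_half_eq_neg_one hωinv) h₈)
      fun _ M₉ ⟨hF₉, h₉⟩ => .op_bind <| .mono (.forLoop (t := 4)
        (I := fun i M' => M'.rounds = pushConv len M.rounds ∧ (∀ a ≠ .mat, M'.nat a = M.nat a) ∧
          M'.cpx = M₉.cpx ∧ ∀ j < i, M'.nat .mat (j + 1) =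
            if SelfMatch (M.nat .str) l len j then 1 else 0) ?_ ?_)
        fun _ M' ⟨e1, e2, _, e3⟩ => ⟨e1, e2, e3⟩
    · have h1 : 1 ≤ 2 ^ K := Nat.one_le_two_pow
      have h2 : (2 ^ K - len) * (4 + 2) ≤ 2 ^ K * 6 := by
        apply Nat.mul_le_mul_right; omega
      have h3 : (2 * len - 1) * (4 + 2) ≤ 2 ^ K * 6 := by
        apply Nat.mul_le_mul_right; omega
      nlinarith
    · exact ⟨CFrame.refl _ _, fun _ h => absurd h (by omega)⟩
    · rintro i hi M' ⟨hF, hM'⟩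
      refine .op_bind <| .readN_bind (by omega) <| .op_bind <| .op_bind <|
        .writeC_bind (by omega) <| .writeC_bind (by omega) <| .writeC (by omega) ?_
      refine ⟨((hF.setC (by simp) _ _).setC (by simp) _ _).setC (by simp) _ _, fun j hj => ?_⟩
      rw [hF.nat, hM₀n]
      simp only [Mem.setC_cpx_self, ne_eq, reduceCtorEq, not_false_eq_true, Mem.setC_cpx_of_ne]
      split_ifs with h
      · subst h
        exact ⟨rfl, by push_cast; ring, by push_cast; ring⟩
      · exact hM' j (by omega)
    · refine ⟨hF₁, fun j hj => ?_⟩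
      rw [if_pos hj, if_pos hj, if_pos hj]
      exact h₁ j hj
    · rintro i hi M' ⟨hF, hM'⟩
      refine .op_bind <| .writeC_bind (by omega) <| .writeC_bind (by omega) <|
        .writeC (by omega) ?_
      refine ⟨((hF.setC (by simp) _ _).setC (by simp) _ _).setC (by simp) _ _, fun j hj => ?_⟩
      simp only [Mem.setC_cpx_self, ne_eq, reduceCtorEq, not_false_eq_true, Mem.setC_cpx_of_ne]
      by_cases h : j = len + i
      · subst h; simp
      · simp only [h, if_false]
        exact hM' j (by omega)
    · exact ⟨CFrame.refl _ _, fun j hj => by simp⟩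
    · rintro i hi M' ⟨hF, hM'⟩
      refine .readC_bind (by omega) <| .readC_bind (by omega) <| .readC_bind (by omega) <|
        .op_bind <| .op_bind <| .op_bind <| .writeC (by omega) ?_
      refine ⟨hF.setC (by simp) _ _, fun j hj => ?_⟩
      rw [Mem.setC_cpx_self]
      by_cases h : j = i
      · subst h
        have g := fun j (hj : j < 2 ^ K) => h₂ j (by omega)
        have hle : len ≤ 2 ^ K := by omega
        have s1 : ∑ a ∈ range (2 ^ K), M₂.cpx .x1 a * ω ^ (a * j) =
            ∑ a ∈ range len, (x a : ℂ) * ω ^ (a * j) := by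
          rw [← sum_range_ite_zero hle]
          exact Finset.sum_congr rfl fun a ha => by rw [(g a (by simpa using ha)).1]
        have s2 : ∑ a ∈ range (2 ^ K), M₂.cpx .x2 a * ω ^ (a * j) =
            ∑ a ∈ range len, (x a : ℂ) ^ 2 * ω ^ (a * j) := by
          rw [← sum_range_ite_zero hle]
          exact Finset.sum_congr rfl fun a ha => by rw [(g a (by simpa using ha)).2.1]
        have s3 : ∑ a ∈ range (2 ^ K), M₂.cpx .x3 a * ω ^ (a * j) =
            ∑ a ∈ range len, (x a : ℂ) ^ 3 * ω ^ (a * j) := by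
          rw [← sum_range_ite_zero hle]
          exact Finset.sum_congr rfl fun a ha => by rw [(g a (by simpa using ha)).2.2]
        rw [if_pos rfl, if_pos (by omega), hM' j hi, if_neg (by omega), hF.cpx _ (by simp),
          hF.cpx _ (by simp), h₆ j hi, hF₆.cpx .x2 (by simp), h₅ j hi, hF₆.cpx .x1 (by simp),
          hF₅.cpx .x1 (by simp), h₄ j hi, hF₅.cpx .x3 (by simp), hF₄.cpx .x3 (by simp),
          hF₄.cpx .x2 (by simp), hF₃.cpx .x1 (by simp), hF₃.cpx .x2 (by simp),
          hF₃.cpx .x3 (by simp), s1, s2, s3]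
      · rw [if_neg h, hM' j hj]
        congr 1
        simp only [eq_iff_iff]; omega
    · have hn : M₉.nat = M.nat := by
        rw [hF₉.nat, hF₈.nat, hF₇.nat, hF₆.nat, hF₅.nat, hF₄.nat, hF₃.nat, hF₂.nat, hM₀n]
      refine ⟨?_, fun a _ => by rw [hn], rfl, fun _ h => absurd h (by omega)⟩
      rw [hF₉.rounds, hF₈.rounds, hF₇.rounds, hF₆.rounds, hF₅.rounds, hF₄.rounds, hF₃.rounds,
        hF₂.rounds, hM₀r]
    · rintro i hi M' ⟨e1, e2, e3, e4⟩
      have hv : M'.cpx .x1 i = ∑ k ∈ range (2 ^ K), D k * ω' ^ (k * i) := by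
        rw [e3, h₉ i (by omega), hF₈.cpx _ (by simp)]
        refine Finset.sum_congr rfl fun j hj => ?_
        have hj := Finset.mem_range.1 hj
        rw [h₇ j hj, if_pos hj]
      have hw : ∀ v : ℕ, (v = if SelfMatch (M.nat .str) l len i then 1 else 0) →
          (M'.setN .mat (i + 1) v).rounds = pushConv len M.rounds ∧
          (∀ a ≠ .mat, (M'.setN .mat (i + 1) v).nat a = M.nat a) ∧
          (M'.setN .mat (i + 1) v).cpx = M₉.cpx ∧
          ∀ j < i + 1, (M'.setN .mat (i + 1) v).nat .mat (j + 1) =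
            if SelfMatch (M.nat .str) l len j then 1 else 0 := by
        intro v hv
        refine ⟨e1, fun a ha => ?_, e3, fun j hj => ?_⟩
        · rw [Mem.setN_nat_of_ne _ ha, e2 a ha]
        · rw [Mem.setN_nat_self]
          by_cases h : j = i
          · subst h; simpa using hv
          · rw [if_neg (by omega), e4 j (by omega)]
      refine .readC_bind (by omega) <| .op_bind <| .op_bind <|
        .ite (t₁ := 1) (t₂ := 1) (fun h => .writeN (by omega) (hw _ ?_))
          fun h => .writeN (by omega) (hw _ ?_)
      · rw [if_pos]
        rw [hv, decide_eq_true_iff] at h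
        exact (hfinal i (by omega)).1 h
      · rw [if_neg]
        rw [hv, decide_eq_true_iff] at h
        exact fun h' => h ((hfinal i (by omega)).2 h')

end WildPal

namespace WildPal

/-! ## Strings and their codes -/

section strings

variable {α : Type*}

theorem hamming_eq_zero_iff (T P : List (Option α)) : hamming T P = 0 ↔
    ∀ j (h : j < T.length) (h' : j < P.length), Matches T[j] P[j] := by
  rw [hamming, List.countP_eq_zero]
  simp only [decide_eq_true_eq]
  constructor
  · intro H j h h'
    exact not_not.1 (H (T[j], P[j]) (List.mem_iff_getElem.2 ⟨j, by simp [h, h'], by simp⟩))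
  · intro H p hp
    obtain ⟨j, hj, rfl⟩ := List.mem_iff_getElem.1 hp
    simp only [List.length_zip, lt_inf_iff] at hj
    simpa using H j hj.1 hj.2

/-- The cases of the definition are overlap at the left end, full overlap and overlap at the right
end; reversing the second string makes the compared positions of `T`, counted from `0`, add up to
`i` in each. -/
theorem cconv_reverse_eq_zero_iff (T : List (Option α)) (i : ℕ) :
    cconv T T.reverse (i + 1) = 0 ↔
      ∀ a b (ha : a < T.length) (hb : b < T.length), a + b = i → Matches T[a] T[b] := by
  unfold cconv
  simp only [List.length_reverse]
  split_ifs with h1 h2 <;> rw [hamming_eq_zero_iff]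
  all_goals
    simp only [factor, List.length_take, List.length_drop, List.length_reverse, List.getElem_take,
      List.getElem_drop, List.getElem_reverse, lt_inf_iff]
  · constructor
    · intro H a b ha hb hab
      convert H a (by omega) (by omega) using 2 <;> omega
    · intro H j h h'
      exact H _ _ _ _ (by omega)
  · constructor
    · intro H a b ha hb hab
      convert H (a - (i + 1 - T.length)) (by omega) (by omega) using 2 <;> omega
    · intro H j h h'
      exact H _ _ _ _ (by omega)
  · constructor
    · intro H a b ha hb hab
      convert H (a - (i + 1 - T.length)) (by omega) (by omega) using 2 <;> omega
    · intro H j h h'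
      exact H _ _ _ _ (by omega)

theorem isPalindrome_iff (T : List (Option α)) : IsPalindrome T ↔
    ∀ a b (ha : a < T.length) (hb : b < T.length), a + b = T.length - 1 → Matches T[a] T[b] := by
  rw [IsPalindrome, List.forall₂_iff_get]
  simp only [List.length_reverse, List.get_eq_getElem, List.getElem_reverse, true_and]
  constructor
  · intro H a b ha hb hab
    convert H a ha ha using 2; omega
  · intro H j h h'
    exact H _ _ _ _ (by omega)

theorem matchN_inputArray (code : α ↪ ℕ) (S : List (Option α)) {p q : ℕ} (hp : p < S.length)
    (hq : q < S.length) :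
    MatchN (inputArray code S (p + 1)) (inputArray code S (q + 1)) ↔ Matches S[p] S[q] := by
  simp only [inputArray, Nat.add_eq_zero_iff, one_ne_zero, and_false, if_false, Nat.add_sub_cancel,
    List.getElem?_eq_getElem hp, List.getElem?_eq_getElem hq]
  rcases S[p] with _ | x <;> rcases S[q] with _ | y <;> simp [MatchN, Matches]

theorem length_factor {S : List (Option α)} {l r : ℕ} (hl : 1 ≤ l) (hlr : l ≤ r)
    (hr : r ≤ S.length) : (factor S l r).length = r - l + 1 := by
  simp only [factor, List.length_take, List.length_drop]; omega

theorem selfMatch_inputArray (code : α ↪ ℕ) {S : List (Option α)} {l r : ℕ} (hl : 1 ≤ l)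
    (hlr : l ≤ r) (hr : r ≤ S.length) (i : ℕ) :
    SelfMatch (inputArray code S) l (r - l + 1) i ↔
      ∀ a b (ha : a < (factor S l r).length) (hb : b < (factor S l r).length), a + b = i →
        Matches (factor S l r)[a] (factor S l r)[b] := by
  have hlen := length_factor hl hlr hr
  have key : ∀ a b (ha : a < (factor S l r).length) (hb : b < (factor S l r).length),
      MatchN (inputArray code S (l + a)) (inputArray code S (l + b)) ↔
        Matches (factor S l r)[a] (factor S l r)[b] := by
    intro a b ha hb
    obtain ⟨l, rfl⟩ : ∃ k, l = k + 1 := ⟨l - 1, by omega⟩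
    rw [add_right_comm l 1 a, add_right_comm l 1 b,
      matchN_inputArray code S (p := l + a) (q := l + b) (by omega) (by omega)]
    simp [factor]
  constructor
  · intro H a b ha hb hab
    exact (key a b ha hb).1 (H a b (by omega) (by omega) hab)
  · intro H a b ha hb hab
    exact (key a b (by omega) (by omega)).2 (H a b (by omega) (by omega) hab)

open Classical in
theorem mconv_factor (code : α ↪ ℕ) {S : List (Option α)} {l r : ℕ} (hl : 1 ≤ l)
    (hlr : l ≤ r) (hr : r ≤ S.length) (i : ℕ) :
    mconv (factor S l r) (factor S l r).reverse (i + 1) =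
      if SelfMatch (inputArray code S) l (r - l + 1) i then 1 else 0 := by
  rw [mconv]
  refine if_congr ?_ rfl rfl
  rw [cconv_reverse_eq_zero_iff,
    selfMatch_inputArray code hl hlr hr]

end strings

/-! ### Palindromes in the array of codes. -/

/-- There is a palindrome of radius `w` around `c` in the string `x 1, …, x n` of codes. -/
def PalAt (x : ℕ → ℕ) (n c w : ℕ) : Prop :=
  w < c ∧ c + w ≤ n ∧ ∀ j ≤ w, MatchN (x (c - j)) (x (c + j))

theorem PalAt.mono {x : ℕ → ℕ} {n c w w' : ℕ} (h : PalAt x n c w) (hw : w' ≤ w) :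
    PalAt x n c w' :=
  ⟨hw.trans_lt h.1, (Nat.add_le_add_left hw c).trans h.2.1, fun j hj => h.2.2 j (hj.trans hw)⟩

theorem palAt_zero {x : ℕ → ℕ} {n c : ℕ} (hc : 1 ≤ c) (hn : c ≤ n) : PalAt x n c 0 :=
  ⟨hc, hn, fun j hj => by
    obtain rfl := Nat.le_zero.1 hj
    exact .inr (.inr rfl)⟩

theorem palAt_succ_iff {x : ℕ → ℕ} {n c w : ℕ} (h : PalAt x n c w) : PalAt x n c (w + 1) ↔
    w + 1 < c ∧ c + (w + 1) ≤ n ∧ MatchN (x (c - (w + 1))) (x (c + (w + 1))) := by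
  refine ⟨fun h' => ⟨h'.1, h'.2.1, h'.2.2 _ le_rfl⟩, fun h' => ⟨h'.1, h'.2.1, fun j hj => ?_⟩⟩
  rcases Nat.le_succ_iff.1 hj with hj | rfl
  · exact h.2.2 j hj
  · exact h'.2.2

/-- Offsets with sum `2 * (c - l)` are the pairs symmetric about `c`, and the nearer end of the
window limits their reach. So one alignment tests the longest candidate at `c`, a prefix or suffix
of the window. -/
theorem selfMatch_iff (x : ℕ → ℕ) {l r c : ℕ} (hl : l ≤ c) (hr : c ≤ r) :
    SelfMatch x l (r - l + 1) (2 * (c - l)) ↔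
      ∀ j ≤ min (c - l) (r - c), MatchN (x (c - j)) (x (c + j)) := by
  constructor
  · intro H j hj
    have := H (c - j - l) (c + j - l) (by omega) (by omega) (by omega)
    convert this using 2 <;> omega
  · intro H a b ha hb hab
    rcases le_total (l + a) c with h | h
    · have := H (c - (l + a)) (by omega)
      convert this using 2 <;> omega
    · have := (H (l + a - c) (by omega)).symm
      convert this using 2 <;> omega

theorem selfMatch_iff_palAt (x : ℕ → ℕ) {n l r c : ℕ} (h1 : 1 ≤ l) (hl : l ≤ c) (hr : c ≤ r)
    (hn : r ≤ n) :
    SelfMatch x l (r - l + 1) (2 * (c - l)) ↔ PalAt x n c (min (c - l) (r - c)) := by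
  rw [selfMatch_iff x hl hr, PalAt]
  refine ⟨fun H => ⟨by omega, by omega, H⟩, fun H => H.2.2⟩

theorem isSubpalindrome_iff {α : Type*} (code : α ↪ ℕ) (S : List (Option α)) {c r : ℕ}
    (hr : r < c) :
    IsSubpalindrome S (c - r) (c + r) ↔ PalAt (inputArray code S) S.length c r := by
  by_cases hn : c + r ≤ S.length
  · have hlen := length_factor (S := S) (l := c - r) (r := c + r) (by omega) (by omega) hn
    rw [IsSubpalindrome, isPalindrome_iff, ← selfMatch_inputArray code (by omega) (by omega) hn]
    have e : (factor S (c - r) (c + r)).length - 1 = 2 * (c - (c - r)) := by omega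
    rw [e, selfMatch_iff_palAt (n := S.length) _ (by omega) (by omega) (by omega) hn]
    have e : min (c - (c - r)) (c + r - c) = r := by omega
    rw [e]
    exact ⟨fun h => h.2.2.2, fun h => ⟨by omega, by omega, hn, h⟩⟩
  · exact ⟨fun h => absurd h.2.2.1 hn, fun h => absurd h.2.1 hn⟩

theorem isMaximalRadius_iff {α : Type*} (code : α ↪ ℕ) (S : List (Option α)) {c r : ℕ} :
    IsMaximalRadius S c r ↔ PalAt (inputArray code S) S.length c r ∧
      ¬ PalAt (inputArray code S) S.length c (r + 1) := by
  rw [IsMaximalRadius, IsMaximalSubpalindrome]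
  constructor
  · rintro ⟨h1, h2, h3⟩
    refine ⟨(isSubpalindrome_iff code S h1).1 h2, fun h => h3 ?_⟩
    have := (isSubpalindrome_iff code S h.1).2 h
    rwa [Nat.sub_sub, Nat.add_assoc]
  · rintro ⟨h1, h3⟩
    refine ⟨h1.1, (isSubpalindrome_iff code S h1.1).2 h1, fun h => h3 ?_⟩
    rw [Nat.sub_sub, Nat.add_assoc] at h
    -- If `c ≤ r + 1`, the truncated left end would be `0`, which is not a position; hence `r + 1 <
    -- c`.
    have := h.1
    exact (isSubpalindrome_iff code S (by omega)).1 h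

theorem exists_maximal_radius {x : ℕ → ℕ} {n c : ℕ} (hc : 1 ≤ c) (hn : c ≤ n) :
    ∃ r, PalAt x n c r ∧ ¬ PalAt x n c (r + 1) ∧ ∀ w, PalAt x n c w ↔ w ≤ r := by
  classical
  have hb : ∀ w, PalAt x n c w → w ≤ c := fun w h => h.1.le
  refine ⟨Nat.findGreatest (PalAt x n c) c, Nat.findGreatest_spec (Nat.zero_le _) (palAt_zero hc hn),
    fun h => ?_, fun w => ⟨fun h => Nat.le_findGreatest (hb w h) h, fun h =>
      (Nat.findGreatest_spec (Nat.zero_le c) (palAt_zero hc hn)).mono h⟩⟩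
  have := Nat.le_findGreatest (hb _ h) h
  omega

/-- The convolution subroutine is correct from every configuration. -/
theorem mconvProg_correct {α : Type*} (code : α ↪ ℕ) (S : List (Option α)) (m : Machine) (l r : ℕ)
    (hm : m.nat .str = inputArray code S) (hl : 1 ≤ l) (hlr : l ≤ r) (hr : r ≤ S.length) :
    ∃ m' : Machine, ((), m') ∈ (mconvProg l r).run m ∧
      ∀ i : ℕ, 1 ≤ i → i ≤ 2 * (r - l + 1) - 1 →
        m'.nat .mat i = mconv (factor S l r) (factor S l r).reverse i := by
  classical
  -- The starting configuration is arbitrary, so the address bound must also cover everything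
  -- accessed before.
  obtain ⟨B, hB⟩ : ∃ B, B = r + 1 + 2 ^ Nat.clog 2 (2 * (r - l + 1)) + m.space := ⟨_, rfl⟩
  have h0 : 0 < 2 ^ Nat.clog 2 (2 * (r - l + 1)) := by positivity
  have hs : m.space ≤ B := by omega
  have hb : m.Bounded B := by
    unfold Machine.space at hs
    constructor <;> rintro (_ | _) <;> omega
  obtain ⟨_, m', h1, -, -, -, -, h2⟩ := runs_mconvProg (B := B) rfl hlr (by omega) (by omega) m.mem m rfl hb
  refine ⟨m', h1, fun i hi hi' => ?_⟩
  obtain ⟨i, rfl⟩ : ∃ k, i = k + 1 := ⟨i - 1, by omega⟩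
  rw [mconv_factor code hl hlr hr, ← hm]
  exact h2 i (by omega)

end WildPal

namespace WildPal

/-! ## Windows -/

/-- Treat the window `S[l .. r]`: compute its self-convolution and update the radii. -/
noncomputable def processWindow (l r : ℕ) : Prog Unit := do
  mconvProg l r
  let len ← op (r - l)
  let len ← op (len + 1)
  forLoop len fun j => do
    let c ← op (l + j)
    let i ← op (2 * j)
    let i ← op (i + 1)
    let z ← readN .mat i
    let z ← op (decide (z = 1))
    if z then do
      let p ← op (c - l)
      let q ← op (r - c)
      let b ← op (decide (p ≤ q))
      let w := if b then p else q
      let old ← readN .rad c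
      let b ← op (decide (old < w))
      if b then writeN .rad c w else pure ()
    else pure ()

/-- The part of `processAnchor` after the left end of the window is known. -/
noncomputable def processFrom (n a v l : ℕ) : Prog Unit := do
  let e ← op (a + v)
  let b ← op (decide (e ≤ n))
  processWindow l (if b then e else n)

theorem processAnchor_eq (n a v : ℕ) : processAnchor n a v = (do
    let b ← op (decide (v < a))
    if b then op (a - v) >>= processFrom n a v else pure 1 >>= processFrom n a v) := rfl

/-- What all steps after the initialization preserve: the input string and the anchors stay, radii
grow, and new radii are radii of palindromes. -/
structure Grows (n : ℕ) (M M' : Mem) : Prop where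
  str : M'.nat .str = M.nat .str
  anch : M'.nat .anch = M.nat .anch
  le : ∀ c, M.nat .rad c ≤ M'.nat .rad c
  palAt : ∀ c, M'.nat .rad c = M.nat .rad c ∨ PalAt (M.nat .str) n c (M'.nat .rad c)

theorem Grows.refl (n : ℕ) (M : Mem) : Grows n M M := ⟨rfl, rfl, fun _ => le_rfl, fun _ => .inl rfl⟩

theorem Grows.trans {n : ℕ} {M₁ M₂ M₃ : Mem} (h : Grows n M₁ M₂) (h' : Grows n M₂ M₃) :
    Grows n M₁ M₃ :=
  ⟨h'.str.trans h.str, h'.anch.trans h.anch, fun c => (h.le c).trans (h'.le c), fun c => by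
    rcases h'.palAt c with e | e
    · rw [e]; exact h.palAt c
    · rw [h.str] at e; exact .inr e⟩

theorem runs_processWindow {B n l r K : ℕ} (hK : K = Nat.clog 2 (2 * (r - l + 1))) (h1 : 1 ≤ l)
    (hl : l ≤ r) (hr : r ≤ n) (hn : n < B) (hB : 2 ^ K ≤ B) (M : Mem) :
    Runs B (processWindow l r) (160 * 2 ^ K * (K + 1)) M (fun _ M' =>
      M'.rounds = pushConv (r - l + 1) M.rounds ∧ Grows n M M' ∧
      ∀ c, l ≤ c → c ≤ r → PalAt (M.nat .str) n c (min (c - l) (r - c)) →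
        min (c - l) (r - c) ≤ M'.nat .rad c) := by
  have hN : 2 * (r - l + 1) ≤ 2 ^ K := hK ▸ Nat.le_pow_clog (by simp) _
  refine Runs.mono_time ?_ <| .bind (runs_mconvProg hK hl (by omega) hB M)
    fun _ M₁ ⟨e1, e2, e3⟩ => .op_bind <| .op_bind <| .mono (.forLoop (t := 11)
    (I := fun j M' => M'.rounds = M₁.rounds ∧ M'.nat .mat = M₁.nat .mat ∧ Grows n M M' ∧
      ∀ c, l ≤ c → c < l + j → PalAt (M.nat .str) n c (min (c - l) (r - c)) →
        min (c - l) (r - c) ≤ M'.nat .rad c) ?_ ?_) ?_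
  · nlinarith
  · refine ⟨rfl, rfl, ⟨e2 _ (by simp), e2 _ (by simp), fun c => ?_, fun c => .inl ?_⟩,
      fun c _ _ => by omega⟩ <;> rw [e2 _ (by simp)]
  · rintro j hj M' ⟨f1, f2, f3, f4⟩
    -- The center `l + j` belongs to the alignment `2 * j`, stored at `2 * j + 1` since `mat` is
    -- indexed from `1`.
    have e : 2 * j = 2 * (l + j - l) := by omega
    have hm := selfMatch_iff_palAt (M.nat .str) (n := n) (c := l + j) h1 (by omega) (by omega) hr
    rw [← e] at hm
    have hmat : M₁.nat .mat (2 * j + 1) = 1 ↔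
        PalAt (M.nat .str) n (l + j) (min (l + j - l) (r - (l + j))) := by
      rw [e3 _ (by omega), ← hm]
      split_ifs with h <;> simp [h]
    set w := min (l + j - l) (r - (l + j)) with hw
    have hw' : (if decide (l + j - l ≤ r - (l + j)) = true then l + j - l else r - (l + j)) = w := by
      simp only [decide_eq_true_iff]
      split_ifs <;> omega
    have skip : (PalAt (M.nat .str) n (l + j) w → w ≤ M'.nat .rad (l + j)) →
        M'.rounds = M₁.rounds ∧ M'.nat .mat = M₁.nat .mat ∧ Grows n M M' ∧
        ∀ c, l ≤ c → c < l + (j + 1) → PalAt (M.nat .str) n c (min (c - l) (r - c)) →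
          min (c - l) (r - c) ≤ M'.nat .rad c := by
      refine fun hs => ⟨f1, f2, f3, fun c hc hc' => ?_⟩
      rcases Nat.lt_succ_iff_lt_or_eq.1 hc' with h | h
      · exact f4 c hc h
      · obtain rfl : c = l + j := h
        exact hs
    refine Runs.mono_time ?_ <| .op_bind <| .op_bind <| .op_bind <| .readN_bind (by omega) <|
      .op_bind <| .ite (t₁ := 6) (t₂ := 0) (fun hz => .op_bind <| .op_bind <| .op_bind <|
        .readN_bind (by omega) <| .op_bind <| .ite (t₁ := 1) (t₂ := 0)
          (fun hlt => .writeN (by omega) ?_) (fun hlt => .pure (skip ?_)))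
      (fun hz => .pure (skip ?_))
    · simp
    · rw [decide_eq_true_iff, f2, hmat] at hz
      rw [hw'] at hlt ⊢
      rw [decide_eq_true_iff] at hlt
      have hrad : ∀ c, (M'.setN .rad (l + j) w).nat .rad c = if c = l + j then w else M'.nat .rad c :=
        fun c => Mem.setN_nat_self _ _ _ _ _
      refine ⟨f1, (Mem.setN_nat_of_ne _ (by simp) _ _).trans f2,
        ⟨(Mem.setN_nat_of_ne _ (by simp) _ _).trans f3.str,
          (Mem.setN_nat_of_ne _ (by simp) _ _).trans f3.anch, fun c => ?_, fun c => ?_⟩,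
        fun c hc hc' => ?_⟩
      · rw [hrad]
        split_ifs with h
        · subst h; exact (f3.le _).trans hlt.le
        · exact f3.le c
      · rw [hrad]
        split_ifs with h
        · subst h; exact .inr hz
        · exact f3.palAt c
      · rw [hrad]
        split_ifs with h
        · subst h; exact fun _ => le_rfl
        · exact f4 c hc (by omega)
    · rw [decide_eq_true_iff] at hlt
      rw [hw'] at hlt
      exact fun _ => not_lt.1 hlt
    · intro h
      rw [decide_eq_true_iff, f2, hmat] at hz
      exact absurd h hz
  · rintro _ M' ⟨f1, f2, f3, f4⟩
    exact ⟨f1.trans e1, f3, fun c hc hc' => f4 c hc (by omega)⟩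

/-- `d` is the distance from `c` to the anchor. If a palindrome of radius `v - d` at `c` fits into
the string, the end of the window nearer to `c` is not clipped, so `v - d` is exactly the radius
tested. -/
theorem runs_processAnchor {B n a v : ℕ} (ha : 1 ≤ a) (han : a ≤ n) (hv : 1 ≤ v) (hn : 4 * n ≤ B)
    (M : Mem) :
    Runs B (processAnchor n a v) (2000 * v * (Nat.clog 2 (2 * n) + 1)) M (fun _ M' =>
      (∃ len ≤ 2 * v + 1, M'.rounds = pushConv len M.rounds) ∧ Grows n M M' ∧
      ∀ c d, (a = c + d ∨ c = a + d) → d ≤ v → PalAt (M.nat .str) n c (v - d) →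
        v - d ≤ M'.nat .rad c) := by
  rw [processAnchor_eq]
  set L := Nat.clog 2 (2 * n) with hL
  obtain ⟨l, hl⟩ : ∃ l, l = if v < a then a - v else 1 := ⟨_, rfl⟩
  obtain ⟨r, hr⟩ : ∃ r, r = if a + v ≤ n then a + v else n := ⟨_, rfl⟩
  have hl1 : 1 ≤ l := by rw [hl]; split_ifs <;> omega
  have hla : l ≤ a := by rw [hl]; split_ifs <;> omega
  have har : a ≤ r := by rw [hr]; split_ifs <;> omega
  have hrn : r ≤ n := by rw [hr]; split_ifs <;> omega
  have hal : a ≤ l + v := by rw [hl]; split_ifs <;> omega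
  have hra : r ≤ a + v := by rw [hr]; split_ifs <;> omega
  obtain ⟨K, hK⟩ : ∃ K, K = Nat.clog 2 (2 * (r - l + 1)) := ⟨_, rfl⟩
  have hKL : K ≤ L := by
    rw [hK, hL]; exact Nat.clog_mono_right _ (by omega)
  have hK0 : 0 < K := hK ▸ Nat.clog_pos (by simp) (by omega)
  -- The transform is shorter than four windows: at most `12 * v` for the time bound and at most `4
  -- * n` for the addresses.
  have hpow : 2 ^ K < 2 * (2 * (r - l + 1)) := by
    obtain ⟨k, rfl⟩ : ∃ k, K = k + 1 := ⟨K - 1, by omega⟩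
    have : 2 ^ k < 2 * (r - l + 1) := (Nat.lt_clog_iff_pow_lt (by simp)).1 (by omega)
    rw [pow_succ]; omega
  have main : Runs B (processFrom n a v l) (160 * 2 ^ K * (K + 1) + 2) M (fun _ M' =>
      (∃ len ≤ 2 * v + 1, M'.rounds = pushConv len M.rounds) ∧ Grows n M M' ∧
      ∀ c d, (a = c + d ∨ c = a + d) → d ≤ v → PalAt (M.nat .str) n c (v - d) →
        v - d ≤ M'.nat .rad c) := by
    have hr' : (if decide (a + v ≤ n) = true then a + v else n) = r := by
      rw [hr]; simp
    refine .op_bind <| .op_bind ?_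
    rw [hr']
    refine (runs_processWindow hK hl1 (by omega) hrn (by omega) (by omega) M).mono ?_
    rintro _ M' ⟨e1, e2, e3⟩
    refine ⟨⟨_, by omega, e1⟩, e2, fun c d had hd hp => ?_⟩
    have h1 := hp.1
    have h2 := hp.2.1
    have e : min (c - l) (r - c) = v - d := by
      rw [hl, hr]; split_ifs <;> omega
    have := e3 c (by rw [hl]; split_ifs <;> omega) (by rw [hr]; split_ifs <;> omega)
    rw [e] at this
    exact this hp
  refine Runs.mono_time ?_ <| .op_bind <| .ite
    (fun h => .op_bind (t := 160 * 2 ^ K * (K + 1) + 2) ?_)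
    (fun h => .pure_bind (t := 160 * 2 ^ K * (K + 1) + 2) ?_)
  rotate_left
  · rw [decide_eq_true_iff] at h
    rw [if_pos h] at hl
    exact hl ▸ main
  · rw [decide_eq_true_iff] at h
    rw [if_neg h] at hl
    exact hl ▸ main
  · have h3 : 2 ^ K ≤ 12 * v := by omega
    have h4 : 2 ^ K * (K + 1) ≤ 12 * v * (L + 1) := Nat.mul_le_mul h3 (by omega)
    have h5 : 1 ≤ v * (L + 1) := Nat.mul_pos hv (by omega)
    simp only [mul_assoc] at h4 ⊢
    omega

end WildPal

namespace WildPal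

/-! ## Initialization -/

theorem runs_alignUpToPowerOfTwo {B : ℕ} (t : ℝ) (M : Mem) :
    Runs B (alignUpToPowerOfTwo t) (3 * Nat.clog 2 ⌈t⌉₊ + 2) M
      (fun p M' => p = 2 ^ Nat.clog 2 ⌈t⌉₊ ∧ M' = M) := by
  set K := Nat.clog 2 ⌈t⌉₊ with hK
  refine Runs.mono_time ?_ <| .whileLoop (k := K) (t₁ := 1) (t₂ := 1)
    (I := fun k p M' => ∃ j, p = 2 ^ j ∧ j + k = K ∧ M' = M) ⟨0, by simp, by simp, rfl⟩ ?_
  · omega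
  · rintro k s _ ⟨j, rfl, hj, rfl⟩
    refine .op ?_
    by_cases h : 2 ^ j < ⌈t⌉₊
    · have hjK : j < K := hK ▸ (Nat.lt_clog_iff_pow_lt (by simp)).2 h
      simp only [Nat.lt_ceil.1 h, decide_true, if_true]
      exact ⟨k - 1, by omega, .op ⟨j + 1, by ring, by omega, rfl⟩⟩
    · have hjK : K ≤ j := hK ▸ (Nat.clog_le_iff_le_pow (by simp)).2 (not_lt.1 h)
      obtain rfl : j = K := by omega
      simp only [mt Nat.lt_ceil.2 h, decide_false]
      simp

theorem runs_matchChars {B : ℕ} (x y : ℕ) (M : Mem) :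
    Runs B (matchChars x y) 5 M (fun b M' => M' = M ∧ (b = true ↔ MatchN x y)) := by
  refine .op_bind <| .op_bind <| .op_bind <| .op_bind <| .op ⟨rfl, ?_⟩
  simp [MatchN, or_assoc]

theorem runs_naivePalFind {B n c u : ℕ} (hc : 1 ≤ c) (hcn : c ≤ n) (hn : n < B) (M : Mem) :
    Runs B (naivePalFind n c u) (15 * u + 14) M (fun r M' => M' = M ∧ PalAt (M.nat .str) n c r ∧
      ∀ w ≤ u, PalAt (M.nat .str) n c w → w ≤ r) := by
  refine Runs.mono_time ?_ <| .whileLoop (k := u) (t₁ := 13) (t₂ := 1)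
    (I := fun k r M' => r + k = u ∧ M' = M ∧ PalAt (M.nat .str) n c r)
    ⟨by simp, rfl, palAt_zero hc hcn⟩ ?_
  · omega
  · rintro k r M₁ ⟨hk, hM, hr⟩
    subst hM
    -- Each of the four ways to leave the loop (limit, left border, right border, mismatch) refutes
    -- this conjunction, and `PalAt.mono` then excludes all larger radii up to `u`.
    have halt : ¬ (r + 1 ≤ u ∧ PalAt (M₁.nat .str) n c (r + 1)) → M₁ = M₁ ∧
        PalAt (M₁.nat .str) n c r ∧ ∀ w ≤ u, PalAt (M₁.nat .str) n c w → w ≤ r := by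
      refine fun h => ⟨rfl, hr, fun w hw hp => ?_⟩
      by_contra hlt
      exact h ⟨by omega, hp.mono (by omega)⟩
    rw [palAt_succ_iff hr] at halt
    refine .op_bind <| .op_bind <| Runs.mono_time (t₁ := 11) le_rfl <| .ite (t₁ := 11) (t₂ := 0)
      (fun h₁ => .op_bind <| .ite (t₁ := 10) (t₂ := 0)
      (fun h₂ => .op_bind <| .op_bind <| .ite (t₁ := 8) (t₂ := 0)
      (fun h₃ => .op_bind <| .readN_bind (by omega) <|
        .readN_bind ?_ <| .mono (runs_matchChars _ _ _) ?_)
      (fun h => .pure ?_)) (fun h => .pure ?_)) (fun h => .pure ?_)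
    all_goals simp only [decide_eq_true_iff] at *
    · omega
    · rintro b _ ⟨rfl, hb⟩
      cases b with
      | true =>
        simp only [if_true]
        refine ⟨k - 1, by omega, .op ⟨by omega, rfl, (palAt_succ_iff hr).2 ⟨h₂, h₃, ?_⟩⟩⟩
        simpa using hb
      | false =>
        simp only [Bool.false_eq_true, if_false, false_iff] at hb ⊢
        refine halt fun h => ?_
        exact hb h.2.2.2
    · exact halt fun h' => h h'.2.2.1
    · exact halt fun h' => h h'.2.1
    · exact halt fun h' => h h'.1

/-! ## The rounds -/

/-- Every palindrome that is a prefix or suffix of the window of size `u` of an anchor is taken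
into account in the radii. -/
def Treated (x : ℕ → ℕ) (n u₀ : ℕ) (u : ℝ) (R : ℕ → ℕ) : Prop :=
  -- `u₀ * 2 ^ e` is the value of `u'` in the round, recovered from `u`; the anchors are the
  -- multiples of half of it.
  ∃ e : ℕ, (u₀ : ℝ) * 2 ^ e ≤ u ∧ u < u₀ * 2 ^ (e + 1) ∧
    ∀ a, 1 ≤ a → a ≤ n → u₀ / 2 * 2 ^ e ∣ a → ∀ c d, (a = c + d ∨ c = a + d) → d ≤ ⌊u⌋₊ →
      PalAt x n c (⌊u⌋₊ - d) → ⌊u⌋₊ - d ≤ R c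

theorem Treated.mono {x : ℕ → ℕ} {n u₀ : ℕ} {u : ℝ} {R R' : ℕ → ℕ} (h : Treated x n u₀ u R)
    (hR : ∀ c, R c ≤ R' c) : Treated x n u₀ u R' := by
  obtain ⟨e, h1, h2, h3⟩ := h
  exact ⟨e, h1, h2, fun a ha han hd c d hcd hdu hp => (h3 a ha han hd c d hcd hdu hp).trans (hR c)⟩

/-- The invariant of the main loop after `j` rounds. -/
structure RoundInv (x : ℕ → ℕ) (n u₀ : ℕ) (g : ℝ) (j : ℕ) (s : Regs) (M : Mem) : Prop where
  u_eq : s.u = u₀ * g ^ j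
  v_eq : s.v = ⌊s.u⌋₊
  u'_eq : ∃ e : ℕ, s.u' = u₀ * 2 ^ e
  u'_le : (s.u' : ℝ) ≤ s.u
  lt_u' : s.u < 2 * s.u'
  cnt_eq : s.cnt = 2 * n / s.u'
  anch : ∀ i, 1 ≤ i → i ≤ s.cnt → M.nat .anch i = i * (s.u' / 2)
  str : M.nat .str = x
  rounds_length : M.rounds.length = j
  rounds : ∀ p ∈ M.rounds, 0 < p.1 ∧ (p.2.length : ℝ) * p.1 ≤ 4 * n ∧ ∀ k ∈ p.2, (k : ℝ) ≤ 3 * p.1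
  palAt : ∀ c, 1 ≤ c → c ≤ n → PalAt x n c (M.nat .rad c)
  naive : ∀ c, 1 ≤ c → c ≤ n → ∀ w ≤ u₀, PalAt x n c w → w ≤ M.nat .rad c
  treated : ∀ i < j, Treated x n u₀ (u₀ * g ^ i) (M.nat .rad)

/-- The body of the main loop. -/
noncomputable def roundBody (n : ℕ) (g : ℝ) (s : Regs) : Prog Regs := do
  logRound s.u
  forLoop s.cnt fun k => do
    let i ← op (k + 1)
    let a ← readN .anch i
    processAnchor n a s.v
  let u ← op (g * s.u)
  let v ← whileLoop
    (fun v : ℕ => do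
      let v1 ← op (v + 1)
      op (decide ((v1 : ℝ) ≤ u)))
    (fun v => op (v + 1))
    s.v
  let u2 ← op (2 * s.u')
  let b ← op (decide ((u2 : ℝ) ≤ u))
  if b then do
    let h ← op (s.cnt / 2)
    forLoop h fun k => do
      let i ← op (k + 1)
      let i2 ← op (2 * i)
      let a ← readN .anch i2
      writeN .anch i a
    pure { u := u, v := v, u' := u2, cnt := h }
  else
    pure { u := u, v := v, u' := s.u', cnt := s.cnt }

/-- The floor is found by counting up. In a round the new `u` is at most `n`, so this linear cost is
absorbed. -/
theorem runs_floor {B : ℕ} {u : ℝ} (hu : 0 ≤ u) {v : ℕ} (hv : v ≤ ⌊u⌋₊) (M : Mem) :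
    Runs B (whileLoop (fun v : ℕ => do
      let v1 ← op (v + 1)
      op (decide ((v1 : ℝ) ≤ u))) (fun v => op (v + 1)) v) (4 * ⌊u⌋₊ + 3) M
      (fun v' M' => v' = ⌊u⌋₊ ∧ M' = M) := by
  refine Runs.mono_time ?_ <| .whileLoop (k := ⌊u⌋₊ - v) (t₁ := 2) (t₂ := 1)
    (I := fun k v M' => v + k = ⌊u⌋₊ ∧ M' = M) ⟨by omega, rfl⟩ ?_
  · omega
  · rintro k v _ ⟨hk, rfl⟩
    refine .op_bind <| .op ?_
    by_cases h : v + 1 ≤ ⌊u⌋₊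
    · simp only [(Nat.le_floor_iff hu).1 h, decide_true, if_true]
      exact ⟨k - 1, by omega, .op ⟨by omega, rfl⟩⟩
    · simp only [mt (Nat.le_floor_iff hu).2 h, decide_false]
      exact ⟨by omega, trivial⟩

/-- The copy can be done in place: when entry `2 * (k + 1)` is read, only entries up to `k` have
been overwritten. -/
theorem runs_halve {B h w : ℕ} (hB : 2 * h < B) {M : Mem}
    (ha : ∀ i, 1 ≤ i → i ≤ 2 * h → M.nat .anch i = i * w) :
    Runs B (forLoop h fun k => do
      let i ← op (k + 1)
      let i2 ← op (2 * i)
      let a ← readN .anch i2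
      writeN .anch i a) (6 * h + 1) M (fun _ M' => M'.rounds = M.rounds ∧
        M'.nat .str = M.nat .str ∧ M'.nat .rad = M.nat .rad ∧
        ∀ i, 1 ≤ i → i ≤ h → M'.nat .anch i = i * (2 * w)) := by
  refine Runs.mono_time ?_ <| .mono (.forLoop (t := 4)
    (I := fun k M' => M'.rounds = M.rounds ∧
        M'.nat .str = M.nat .str ∧ M'.nat .rad = M.nat .rad ∧
        ∀ i, 1 ≤ i → i ≤ 2 * h → M'.nat .anch i = if i ≤ k then i * (2 * w) else i * w)
    ⟨rfl, rfl, rfl, fun i hi hi' => by rw [if_neg (by omega), ha i hi hi']⟩ ?_) ?_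
  · omega
  · rintro k hk M' ⟨e1, e2, e3, e4⟩
    refine .op_bind <| .op_bind <| .readN_bind (by omega) <| .writeN (by omega) ?_
    refine ⟨e1, (Mem.setN_nat_of_ne _ (by simp) _ _).trans e2,
      (Mem.setN_nat_of_ne _ (by simp) _ _).trans e3, fun i hi hi' => ?_⟩
    rw [Mem.setN_nat_self]
    by_cases h : i = k + 1
    · rw [if_pos h, if_pos h.le, e4 _ (by omega) (by omega), if_neg (by omega), h]
      ring
    · rw [if_neg h, e4 i hi hi']
      split_ifs <;> first | rfl | omega
  · rintro _ M' ⟨e1, e2, e3, e4⟩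
    exact ⟨e1, e2, e3, fun i hi hi' => by rw [e4 i hi (by omega), if_pos hi']⟩

theorem runs_anchors {B n cnt v w : ℕ} (hv : 1 ≤ v) (hw : 1 ≤ w) (hcnt : cnt * w ≤ n) (hn : 4 * n ≤ B)
    {M : Mem} {u : ℝ} {t : List (ℝ × List ℕ)} (hM : M.rounds = (u, []) :: t)
    (ha : ∀ i, 1 ≤ i → i ≤ cnt → M.nat .anch i = i * w) :
    Runs B (forLoop cnt fun k => do
      let i ← op (k + 1)
      let a ← readN .anch i
      processAnchor n a v) (cnt * (2000 * v * (Nat.clog 2 (2 * n) + 1) + 4) + 1) M (fun _ M' =>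
        (∃ L : List ℕ, M'.rounds = (u, L) :: t ∧ L.length = cnt ∧ ∀ k ∈ L, k ≤ 2 * v + 1) ∧
        Grows n M M' ∧ ∀ i, 1 ≤ i → i ≤ cnt → ∀ c d, (i * w = c + d ∨ c = i * w + d) → d ≤ v →
          PalAt (M.nat .str) n c (v - d) → v - d ≤ M'.nat .rad c) := by
  refine Runs.mono_time ?_ <| .forLoop (t := 2000 * v * (Nat.clog 2 (2 * n) + 1) + 2)
    (I := fun k M' =>
        (∃ L : List ℕ, M'.rounds = (u, L) :: t ∧ L.length = k ∧ ∀ k ∈ L, k ≤ 2 * v + 1) ∧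
        Grows n M M' ∧ ∀ i, 1 ≤ i → i ≤ k → ∀ c d, (i * w = c + d ∨ c = i * w + d) → d ≤ v →
          PalAt (M.nat .str) n c (v - d) → v - d ≤ M'.nat .rad c)
    ⟨⟨[], hM, rfl, by simp⟩, .refl _ _, fun i hi hi' => by omega⟩ ?_
  · exact le_rfl
  · rintro k hk M' ⟨⟨L, e1, e2, e3⟩, f1, f2⟩
    have hk1 : (k + 1) * w ≤ n := (Nat.mul_le_mul_right _ hk).trans hcnt
    have hk2 : k + 1 ≤ (k + 1) * w := Nat.le_mul_of_pos_right _ hw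
    have hanch : M'.nat .anch (k + 1) = (k + 1) * w := by rw [f1.anch, ha _ (by omega) hk]
    refine .op_bind <| .readN_bind (by omega) <| .mono
      (runs_processAnchor (by rw [hanch]; omega) (by rw [hanch]; omega) hv hn M') ?_
    rintro _ M'' ⟨⟨len, g1, g2⟩, g3, g4⟩
    refine ⟨⟨len :: L, by rw [g2, e1]; rfl, by simp [e2], ?_⟩, f1.trans g3,
      fun i hi hi' c d hcd hd hp => ?_⟩
    · rintro k (_ | ⟨_, hk⟩)
      · exact g1
      · exact e3 k hk
    · rcases Nat.le_succ_iff.1 hi' with h | rfl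
      · exact (f2 i hi h c d hcd hd hp).trans (g3.le c)
      · rw [hanch] at g4
        exact g4 c d hcd hd (by rwa [f1.str])

end WildPal

/-! ### One full round, and the whole program. -/

namespace WildPal

theorem runs_roundBody {x : ℕ → ℕ} {B n u₀ k₀ j : ℕ} {g : ℝ} {s : Regs} {M : Mem} (hn : 2 ≤ n)
    (hB : 4 * n < B) (hu₀ : u₀ = 2 * k₀) (hk₀ : 1 ≤ k₀) (hg1 : 1 ≤ g) (hg2 : g ≤ 2)
    (h : RoundInv x n u₀ g j s M) (hs : s.u < (n : ℝ) / 2) :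
    Runs B (roundBody n g s) (8100 * n * (Nat.clog 2 (2 * n) + 1)) M
      (fun s' M' => RoundInv x n u₀ g (j + 1) s' M') := by
  obtain ⟨e, he⟩ := h.u'_eq
  obtain ⟨w, hw⟩ : ∃ w, w = k₀ * 2 ^ e := ⟨_, rfl⟩
  have hu' : s.u' = 2 * w := by rw [he, hu₀, hw]; ring
  have hw1 : 1 ≤ w := hw ▸ Nat.mul_pos hk₀ (by positivity)
  have hw2 : s.u' / 2 = w := by omega
  have hstep : u₀ / 2 * 2 ^ e = w := by rw [hw, hu₀]; simp
  have hcnt : s.cnt * s.u' ≤ 2 * n := by rw [h.cnt_eq]; exact Nat.div_mul_le_self _ _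
  have hcntw : s.cnt * w ≤ n := by
    rw [hu', ← mul_assoc, mul_right_comm] at hcnt; omega
  have hu0 : 0 ≤ s.u := (Nat.cast_nonneg _).trans h.u'_le
  have hvu : (s.v : ℝ) ≤ s.u := by rw [h.v_eq]; exact Nat.floor_le hu0
  have hv1 : s.u' ≤ s.v := by rw [h.v_eq]; exact Nat.le_floor h.u'_le
  have hv2 : s.v ≤ 2 * s.u' := by
    have h1 := hvu.trans h.lt_u'.le
    exact_mod_cast h1
  have hu1 : 1 ≤ s.u := by
    have : (1 : ℝ) ≤ s.u' := by exact_mod_cast (by omega : 1 ≤ s.u')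
    linarith [h.u'_le]
  have hgu : s.u ≤ g * s.u := by nlinarith
  have hgu2 : g * s.u ≤ 2 * s.u := by nlinarith
  have hfl : ⌊g * s.u⌋₊ ≤ n := by
    have h1 : (⌊g * s.u⌋₊ : ℝ) ≤ n := (Nat.floor_le (by linarith)).trans (by linarith)
    exact_mod_cast h1
  -- The core of the time bound: the windows of one round have linear total length, whatever `u` is.
  have hcv : s.cnt * s.v ≤ 4 * n := by
    calc s.cnt * s.v ≤ s.cnt * (2 * s.u') := Nat.mul_le_mul_left _ hv2
      _ = 2 * (s.cnt * s.u') := by ring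
      _ ≤ 4 * n := by omega
  have hcnt2 : s.cnt ≤ n := (Nat.le_mul_of_pos_right _ hw1).trans hcntw
  have hu_new : g * s.u = u₀ * g ^ (j + 1) := by rw [h.u_eq]; ring
  refine Runs.mono_time ?_ <| .logRound_bind <| .bind
    (runs_anchors (w := w) (by omega) hw1 hcntw (by omega) rfl (fun i hi hi' => by
      rw [← hw2]; exact h.anch i hi hi'))
    fun _ M₁ ⟨⟨L, r1, r2, r3⟩, hG, hT⟩ => .op_bind <| .bind
    (runs_floor (by linarith) (by rw [h.v_eq]; exact Nat.floor_le_floor hgu) M₁)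
    fun v M₂ h₂ => .op_bind <| .op_bind (t := 3 * n + 2) ?_
  · have h1 : 1 ≤ n * (Nat.clog 2 (2 * n) + 1) := Nat.mul_pos (by omega) (by omega)
    have h2 : s.cnt * (2000 * s.v * (Nat.clog 2 (2 * n) + 1) + 4) ≤
        8000 * (n * (Nat.clog 2 (2 * n) + 1)) + 4 * n := by
      have := Nat.mul_le_mul_right (2000 * (Nat.clog 2 (2 * n) + 1)) hcv
      nlinarith
    have h3 : n ≤ n * (Nat.clog 2 (2 * n) + 1) := Nat.le_mul_of_pos_right _ (by omega)
    rw [mul_assoc 8100]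
    omega
  obtain ⟨rfl, rfl⟩ := h₂
  have hGle : ∀ c, M.nat .rad c ≤ M₂.nat .rad c := hG.le
  have hGpal : ∀ c, M₂.nat .rad c = M.nat .rad c ∨ PalAt x n c (M₂.nat .rad c) := by
    intro c; rw [← h.str]; exact hG.palAt c
  -- Everything except the anchor bookkeeping is the same whether or not the anchors are thinned
  -- out.
  have common : ∀ (M₃ : Mem) (u' cnt : ℕ), M₃.rounds = M₂.rounds → M₃.nat .str = M₂.nat .str →
      M₃.nat .rad = M₂.nat .rad → (∃ e : ℕ, u' = u₀ * 2 ^ e) → (u' : ℝ) ≤ g * s.u →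
      g * s.u < 2 * u' → cnt = 2 * n / u' →
      (∀ i, 1 ≤ i → i ≤ cnt → M₃.nat .anch i = i * (u' / 2)) →
      RoundInv x n u₀ g (j + 1) ⟨g * s.u, ⌊g * s.u⌋₊, u', cnt⟩ M₃ := by
    intro M₃ u' cnt e1 e2 e3 e4 e5 e6 e7 e8
    refine ⟨hu_new, rfl, e4, e5, e6, e7, e8, e2.trans (hG.str.trans h.str), ?_, ?_, ?_, ?_, ?_⟩
    · rw [e1, r1, List.length_cons, h.rounds_length]
    · rw [e1, r1]
      intro p hp
      rcases List.mem_cons.1 hp with rfl | hp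
      · refine ⟨by linarith, ?_, fun k hk => ?_⟩
        · have h1 : (s.cnt : ℝ) * s.u' ≤ 2 * n := by exact_mod_cast hcnt
          have h2 := mul_le_mul_of_nonneg_left h.lt_u'.le (Nat.cast_nonneg (α := ℝ) s.cnt)
          rw [r2]
          simp only
          linarith
        · have h1 : (k : ℝ) ≤ 2 * s.v + 1 := by exact_mod_cast r3 k hk
          simp only
          linarith
      · exact h.rounds p hp
    · intro c hc hcn
      rw [e3]
      rcases hGpal c with h' | h'
      · rw [h']; exact h.palAt c hc hcn
      · exact h'
    · intro c hc hcn w hw hp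
      rw [e3]
      exact (h.naive c hc hcn w hw hp).trans (hGle c)
    · intro i hi
      rw [e3]
      rcases Nat.lt_succ_iff_lt_or_eq.1 hi with hi | rfl
      · exact (h.treated i hi).mono hGle
      · rw [← h.u_eq]
        refine ⟨e, ?_, ?_, ?_⟩
        · have := h.u'_le
          rw [he] at this
          exact_mod_cast this
        · have := h.lt_u'
          rw [he] at this
          push_cast at this
          rw [pow_succ]; linarith
        · rw [hstep, ← h.v_eq, ← h.str]
          rintro a ha han ⟨i, rfl⟩ c d hcd hd hp
          rw [mul_comm w i] at *
          refine hT i ?_ ?_ c d hcd hd hp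
          · exact Nat.pos_of_ne_zero (by rintro rfl; simp at ha)
          -- The count `2 * n / u'` makes every multiple of `w = u' / 2` up to `n` an anchor.
          · rw [h.cnt_eq, Nat.le_div_iff_mul_le (by omega), hu', ← mul_assoc, mul_right_comm]
            omega
  refine Runs.mono_time ?_ <| .ite (t₁ := 3 * n + 2) (t₂ := 0) (fun hb => Runs.mono_time ?_ <|
    .op_bind <| .bind (runs_halve (w := w) (h := s.cnt / 2) (by omega) fun i hi hi' => ?_)
      fun _ M₃ ⟨e1, e2, e3, e4⟩ => .pure ?_) (fun hb => .pure ?_)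
  · omega
  · omega
  · rw [hG.anch, ← hw2]; exact h.anch i hi (by omega)
  · rw [decide_eq_true_iff] at hb
    refine common M₃ (2 * s.u') _ e1 e2 e3 ⟨e + 1, by rw [he]; ring⟩ hb ?_ ?_ ?_
    -- One thinning suffices: `s.u < 2 * s.u'` and `g ≤ 2` give `g * s.u < 4 * s.u'`.
    · push_cast; linarith [h.lt_u']
    · rw [h.cnt_eq, Nat.div_div_eq_div_mul, mul_comm s.u']
    · intro i hi hi'
      rw [e4 i hi hi', hu']
      congr 1; omega
  · rw [decide_eq_true_iff, not_le] at hb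
    push_cast at hb
    refine common M₂ s.u' _ rfl rfl rfl ⟨e, he⟩ (by linarith [h.u'_le]) hb h.cnt_eq fun i hi hi' => ?_
    rw [hG.anch]; exact h.anch i hi hi'

theorem approxPal_eq (n : ℕ) (ε : ℝ) : approxPal n ε = (do
    let δ ← op (ε / 2)
    forLoop n fun k => do
      let c ← op (k + 1)
      writeN .rad c 0
    let t ← op (1 / δ)
    let u₀ ← alignUpToPowerOfTwo t
    forLoop n fun k => do
      let c ← op (k + 1)
      let r ← naivePalFind n c u₀
      writeN .rad c r
    let step ← op (u₀ / 2)
    let cnt ← op (2 * n)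
    let cnt ← op (cnt / u₀)
    forLoop cnt fun k => do
      let i ← op (k + 1)
      let a ← op (i * step)
      writeN .anch i a
    let g ← op (1 + δ)
    let half ← op ((n : ℝ) / 2)
    let _ ← whileLoop (fun s : Regs => op (decide (s.u < half))) (roundBody n g)
      { u := (u₀ : ℝ), v := u₀, u' := u₀, cnt := cnt }
    pure ()) := rfl

theorem runs_approxPal {x : ℕ → ℕ} {B n J K : ℕ} {ε : ℝ} (hn : 2 ≤ n) (hB : 4 * n < B)
    (hε : 0 < ε) (hε' : ε ≤ 1 / 2) (hK : K = Nat.clog 2 ⌈1 / (ε / 2)⌉₊)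
    (hJ : (n : ℝ) ≤ (1 + ε / 2) ^ J) {M : Mem} (hM : M.nat .str = x) (hr : M.rounds = []) :
    Runs B (approxPal n ε) (110 * n * 2 ^ K + J * (8102 * n * (Nat.clog 2 (2 * n) + 1))) M
      (fun _ M' => ∃ j ≤ J, ∃ s, RoundInv x n (2 ^ K) (1 + ε / 2) j s M' ∧ (n : ℝ) / 2 ≤ s.u) := by
  rw [approxPal_eq]
  have h4 : (4 : ℝ) ≤ 1 / (ε / 2) := by
    rw [le_div_iff₀ (by linarith)]; linarith
  have hK2 : 2 ≤ K := by
    rw [hK]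
    by_contra hlt
    have : ⌈1 / (ε / 2)⌉₊ ≤ 2 ^ 1 := (Nat.clog_le_iff_le_pow (by simp)).1 (by omega)
    have := (Nat.le_ceil (1 / (ε / 2))).trans (Nat.cast_le.2 this)
    norm_num at this
    norm_num at h4
    linarith
  obtain ⟨k₀, hk₀, hk₀'⟩ : ∃ k₀, 2 ^ K = 2 * k₀ ∧ 1 ≤ k₀ := by
    obtain ⟨k, rfl⟩ : ∃ k, K = k + 1 := ⟨K - 1, by omega⟩
    exact ⟨2 ^ k, by ring, Nat.one_le_two_pow⟩
  have hpos : 1 ≤ 2 ^ K := Nat.one_le_two_pow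
  obtain ⟨u₀, hu₀⟩ : ∃ u, u = 2 ^ K := ⟨_, rfl⟩
  rw [← hu₀] at hk₀ hpos ⊢
  have hcnt : 2 * n / u₀ * u₀ ≤ 2 * n := Nat.div_mul_le_self _ _
  have hcnt' : 2 * n / u₀ ≤ n := by
    rw [hk₀, Nat.mul_div_mul_left _ _ (by simp)]; exact Nat.div_le_self _ _
  refine Runs.mono_time ?_ <| .op_bind <| .bind (.forLoop (t := 2)
    (I := fun _ M' => M'.nat .str = x ∧ M'.rounds = []) ⟨hM, hr⟩ ?_)
    fun _ M₁ h₁ => .op_bind <| .bind (runs_alignUpToPowerOfTwo _ _) fun u M₂ h₂ =>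
    .bind (t₁ := n * (15 * u₀ + 18) + 1) (t₂ := 5 * n + 12 + J * (8102 * n * (Nat.clog 2 (2 * n) + 1)))
      (R := fun _ M' => M'.nat .str = x ∧ M'.rounds = [] ∧ ∀ c, 1 ≤ c → c ≤ n →
        PalAt x n c (M'.nat .rad c) ∧ ∀ w ≤ u₀, PalAt x n c w → w ≤ M'.nat .rad c)
      ?_ fun _ M₃ h₃ => ?_
  · rw [← hK]
    have h5 : n * (15 * u₀ + 18) = 15 * (n * u₀) + 18 * n := by ring
    have h1 : K < u₀ := hu₀ ▸ Nat.lt_two_pow_self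
    have h2 : u₀ ≤ n * u₀ := Nat.le_mul_of_pos_left _ (by omega)
    have h3 : n * 4 ≤ n * u₀ := Nat.mul_le_mul_left _ (by
      calc 4 = 2 ^ 2 := rfl
        _ ≤ u₀ := hu₀ ▸ Nat.pow_le_pow_right (by simp) hK2)
    rw [h5, mul_assoc 110]
    omega
  · rintro i hi M' ⟨e1, e2⟩
    exact .op_bind <| .writeN (by omega) ⟨(Mem.setN_nat_of_ne _ (by simp) _ _).trans e1, e2⟩
  · obtain ⟨hu, rfl⟩ := h₂
    rw [hu, ← hK, ← hu₀]
    refine (Runs.forLoop (t := 15 * u₀ + 16) (I := fun i M' => M'.nat .str = x ∧ M'.rounds = [] ∧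
      ∀ c, 1 ≤ c → c ≤ i → PalAt x n c (M'.nat .rad c) ∧
        ∀ w ≤ u₀, PalAt x n c w → w ≤ M'.nat .rad c) ⟨h₁.1, h₁.2, fun c _ _ => by omega⟩ ?_).mono_time
          le_rfl
    rintro i hi M' ⟨e1, e2, e3⟩
    refine Runs.mono_time ?_ <| .op_bind <| .bind (runs_naivePalFind (by omega) (by omega : i + 1 ≤ n)
      (by omega) M') fun r M'' h'' => .writeN (by omega) ?_
    · omega
    obtain ⟨rfl, hr1, hr2⟩ := h''
    rw [e1] at hr1 hr2
    refine ⟨(Mem.setN_nat_of_ne _ (by simp) _ _).trans e1, e2, fun c hc hc' => ?_⟩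
    rw [Mem.setN_nat_self]
    split_ifs with h
    · rw [h]; exact ⟨hr1, hr2⟩
    · exact e3 c hc (by omega)
  · rw [h₂.1, ← hK, ← hu₀]
    obtain ⟨a1, a2, a3⟩ := h₃
    have hg1 : 1 ≤ 1 + ε / 2 := by linarith
    refine Runs.mono_time ?_ <| .op_bind <| .op_bind <| .op_bind <| .bind (.forLoop (t := 3)
      (I := fun i M' => M'.nat .str = x ∧ M'.rounds = [] ∧ M'.nat .rad = M₃.nat .rad ∧
        ∀ k, 1 ≤ k → k ≤ i → M'.nat .anch k = k * (u₀ / 2))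
      ⟨a1, a2, rfl, fun k _ _ => by omega⟩ ?_) fun _ M₄ ⟨b1, b2, b3, b4⟩ => .op_bind <| .op_bind <|
      .bind (.whileLoop (k := J) (t₁ := 1) (t₂ := 8100 * n * (Nat.clog 2 (2 * n) + 1))
        (I := fun k s M' => ∃ j, j + k = J ∧ RoundInv x n u₀ (1 + ε / 2) j s M')
        (Q := fun s M' => ∃ j ≤ J, RoundInv x n u₀ (1 + ε / 2) j s M' ∧ (n : ℝ) / 2 ≤ s.u) ?_ ?_)
      fun s M' ⟨j, hj, hI, hs⟩ => .pure ⟨j, hj, s, hI, hs⟩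
    · have h1 : 1 ≤ n * (Nat.clog 2 (2 * n) + 1) := Nat.mul_pos (by omega) (by omega)
      have h2 : J * (1 + 8100 * n * (Nat.clog 2 (2 * n) + 1) + 1) ≤
          J * (8102 * n * (Nat.clog 2 (2 * n) + 1)) := Nat.mul_le_mul_left _ (by nlinarith)
      omega
    · rintro i hi M' ⟨e1, e2, e3, e4⟩
      refine .op_bind <| .op_bind <| .writeN (by omega)
        ⟨(Mem.setN_nat_of_ne _ (by simp) _ _).trans e1, e2,
          (Mem.setN_nat_of_ne _ (by simp) _ _).trans e3, fun k hk hk' => ?_⟩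
      rw [Mem.setN_nat_self]
      split_ifs with h
      · rw [h]
      · exact e4 k hk (by omega)
    · have hu1 : (1 : ℝ) ≤ u₀ := by exact_mod_cast hpos
      refine ⟨0, by simp, by simp, by simp, ⟨0, by simp⟩, le_rfl, ?_, rfl, b4, b1, by simp [b2],
        by simp [b2], fun c hc hc' => ?_, fun c hc hc' => ?_, fun i hi => absurd hi (by omega)⟩
      · simp only; linarith
      · rw [b3]; exact (a3 c hc hc').1
      · rw [b3]; exact (a3 c hc hc').2
    · rintro k s M' ⟨j, hj, hI⟩
      refine .op ?_
      by_cases hs : s.u < (n : ℝ) / 2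
      · simp only [hs, decide_true, if_true]
        rcases k with _ | k
        -- After `J` rounds `u = u₀ * g ^ J ≥ n`, which contradicts the loop test.
        · obtain rfl : j = J := by omega
          exfalso
          have hu1 : (1 : ℝ) ≤ u₀ := by exact_mod_cast hpos
          have hn0 : (2 : ℝ) ≤ n := by exact_mod_cast hn
          have := hI.u_eq
          nlinarith
        · exact ⟨k, rfl, (runs_roundBody hn hB hk₀ hk₀' hg1 (by linarith) hI hs).mono
            fun s' M'' h' => ⟨j + 1, by omega, h'⟩⟩
      · simp only [hs, decide_false]
        exact ⟨j, by omega, hI, not_lt.1 hs⟩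

end WildPal

namespace WildPal

/-! ## Approximation -/

/-- The distance from `c` to the nearest multiple of `w` in `1, …, n`. -/
noncomputable def anchorDist (n w c : ℕ) : ℕ :=
  sInf {d | ∃ a, 1 ≤ a ∧ a ≤ n ∧ w ∣ a ∧ (a = c + d ∨ c = a + d)}

theorem anchorDist_le {n w c a d : ℕ} (ha : 1 ≤ a) (han : a ≤ n) (hw : w ∣ a)
    (h : a = c + d ∨ c = a + d) : anchorDist n w c ≤ d :=
  Nat.sInf_le ⟨a, ha, han, hw, h⟩

/-- `w ∣ n` makes `n` itself an anchor, so the infimum is attained and is not the default `0` of an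
empty set. -/
theorem exists_anchorDist {n w : ℕ} (c : ℕ) (hn : 1 ≤ n) (hw : w ∣ n) :
    ∃ a, 1 ≤ a ∧ a ≤ n ∧ w ∣ a ∧ (a = c + anchorDist n w c ∨ c = a + anchorDist n w c) := by
  refine Nat.sInf_mem (s := {d | ∃ a, 1 ≤ a ∧ a ≤ n ∧ w ∣ a ∧ (a = c + d ∨ c = a + d)}) ?_
  rcases le_total c n with h | h
  · exact ⟨n - c, n, hn, le_rfl, hw, by omega⟩
  · exact ⟨c - n, n, hn, le_rfl, hw, by omega⟩

theorem anchorDist_mono {n w w' : ℕ} (c : ℕ) (hn : 1 ≤ n) (hw : w ∣ w') (hw' : w' ∣ n) :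
    anchorDist n w c ≤ anchorDist n w' c := by
  obtain ⟨a, h1, h2, h3, h4⟩ := exists_anchorDist c hn hw'
  exact anchorDist_le h1 h2 (hw.trans h3) h4

/-- `w ≤ 2 * c` is needed because `0` is not an anchor; to the right the next multiple always
exists, since `w ∣ n`. -/
theorem two_mul_anchorDist_le {n w c : ℕ} (hn : 1 ≤ n) (hw : w ∣ n) (hw1 : 1 ≤ w) (hcn : c ≤ n)
    (hc : w ≤ 2 * c) : 2 * anchorDist n w c ≤ w := by
  rcases lt_or_ge c w with h | h
  · have := anchorDist_le (c := c) (d := w - c) hw1 (Nat.le_of_dvd hn hw) dvd_rfl (by omega)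
    omega
  · have hd := Nat.mod_add_div c w
    have hm := Nat.mod_lt c hw1
    have hq : 1 ≤ c / w := Nat.div_pos h hw1
    have h1 := anchorDist_le (n := n) (w := w) (c := c) (a := w * (c / w)) (d := c % w)
      (Nat.mul_pos hw1 hq) (by omega) (dvd_mul_right _ _) (by omega)
    by_cases h0 : c % w = 0
    · omega
    · obtain ⟨q, rfl⟩ := hw
      have h2 : c / w < q := by
        have : w * (c / w) < w * q := by omega
        exact lt_of_mul_lt_mul_left this (Nat.zero_le _)
      have h3 : w * (c / w) + w ≤ w * q := by
        rw [← Nat.mul_succ]; exact Nat.mul_le_mul_left _ h2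
      have h4 := anchorDist_le (n := w * q) (w := w) (c := c) (a := w * (c / w) + w) (d := w - c % w)
        (by omega) h3 ((dvd_mul_right _ _).add dvd_rfl) (by omega)
      omega

/-- The slack is `δ * (u - 2 - 2 * d)`, which is nonnegative for `d ≤ u / 4` and `u ≥ 4` even after
the loss of the floor. -/
theorem window_ratio_step {δ u v d r : ℝ} (hδ : 0 < δ) (hu : 4 ≤ u) (hv : u < v + 1)
    (hd : 4 * d ≤ u) (hr : r + d + 1 ≤ (1 + δ) * u) : r ≤ (1 + 2 * δ) * (v - d) := by
  have h1 : (1 + 2 * δ) * (u - 1 - d) ≤ (1 + 2 * δ) * (v - d) :=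
    mul_le_mul_of_nonneg_left (by linarith) (by linarith)
  have h2 : 0 ≤ δ * (u - 2 - 2 * d) := mul_nonneg hδ.le (by linarith)
  nlinarith

theorem window_ratio_last {δ h u v d r : ℝ} (hδ : 0 < δ) (hδ' : δ ≤ 1 / 4) (hh : 16 ≤ h)
    (hδh : 2 ≤ δ * h) (hu : h ≤ (1 + δ) * u) (hv : u < v + 1) (hd : 8 * d ≤ h) (hr : r + d ≤ h) :
    r ≤ (1 + 2 * δ) * (v - d) := by
  -- The goal reduces to `1 + δ + 2 * δ * d ≤ δ * v`; multiplying by `1 + δ` and inserting `d ≤ h /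
  -- 8` gives this. Small `δ` uses `δ * h ≥ 2`, large `δ` uses `h ≥ 16`.
  have key : 1 + 3 * δ + 2 * δ ^ 2 ≤ δ * h * (3 / 4 - δ / 4) := by
    rcases le_total δ (1 / 8) with h8 | h8
    · have := mul_le_mul_of_nonneg_right hδh (by linarith : 0 ≤ 3 / 4 - δ / 4)
      nlinarith
    · have h16 : δ * 16 ≤ δ * h := mul_le_mul_of_nonneg_left hh hδ.le
      have := mul_le_mul_of_nonneg_right h16 (by linarith : 0 ≤ 3 / 4 - δ / 4)
      nlinarith
  have h1 : h ≤ (1 + δ) * (v + 1) := hu.trans (mul_le_mul_of_nonneg_left hv.le (by linarith))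
  have h2 : (1 + δ) * (1 + δ + 2 * δ * d) ≤ (1 + δ) * (δ * v) := by
    have h3 : δ * h ≤ δ * ((1 + δ) * (v + 1)) := mul_le_mul_of_nonneg_left h1 hδ.le
    have h4 : (1 + δ) * δ * (8 * d) ≤ (1 + δ) * δ * h :=
      mul_le_mul_of_nonneg_left hd (mul_nonneg (by linarith) hδ.le)
    nlinarith
  have h5 := le_of_mul_le_mul_left h2 (by linarith)
  nlinarith

theorem approx_of_treated {x R : ℕ → ℕ} {n m K u₀ c r j : ℕ} {ε : ℝ} (hn : n = 2 * 2 ^ m)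
    (hu₀ : u₀ = 2 ^ K) (hK : 2 ≤ K) (hδ : 1 ≤ ε / 2 * u₀) (hε : 0 < ε) (hε' : ε ≤ 1 / 2)
    (hj : (n : ℝ) / 2 ≤ u₀ * (1 + ε / 2) ^ j) (hr : ∀ w, PalAt x n c w ↔ w ≤ r)
    (hnaive : ∀ w ≤ u₀, PalAt x n c w → w ≤ R c)
    (ht : ∀ i < j, Treated x n u₀ (u₀ * (1 + ε / 2) ^ i) R) : (r : ℝ) ≤ (1 + ε) * R c := by
  rcases le_or_gt r u₀ with hru | hru
  · have h1 : (r : ℝ) ≤ R c := by exact_mod_cast hnaive r hru ((hr r).2 le_rfl)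
    nlinarith [Nat.cast_nonneg (α := ℝ) (R c)]
  obtain ⟨hrc, hrn, -⟩ := (hr r).2 le_rfl
  set g : ℝ := 1 + ε / 2 with hg
  have hg1 : 1 < g := by linarith
  set h : ℕ := 2 ^ m with hh
  have hnh : (n : ℝ) / 2 = h := by rw [hn]; push_cast; ring
  rw [hnh] at hj
  have hu4 : 4 ≤ u₀ := by
    calc 4 = 2 ^ 2 := rfl
      _ ≤ u₀ := hu₀ ▸ Nat.pow_le_pow_right (by simp) hK
  have hu4' : (4 : ℝ) ≤ u₀ := by exact_mod_cast hu4
  classical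
  have hex : ∃ i, (h : ℝ) ≤ u₀ * g ^ i := ⟨j, hj⟩
  obtain ⟨N, hN⟩ : ∃ N, N = Nat.find hex := ⟨_, rfl⟩
  have hNj : N ≤ j := hN ▸ Nat.find_min' hex hj
  have hNspec : (h : ℝ) ≤ u₀ * g ^ N := hN ▸ Nat.find_spec hex
  have hNmin : ∀ i < N, (u₀ : ℝ) * g ^ i < h := fun i hi =>
    not_le.1 (Nat.find_min hex (hN ▸ hi))
  have hN0 : 0 < N := by
    rw [Nat.pos_iff_ne_zero]
    intro h0
    rw [h0, pow_zero, mul_one] at hNspec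
    have : h ≤ u₀ := by exact_mod_cast hNspec
    omega
  choose! e he1 he2 he3 using fun i (hi : i < N) => ht i (by omega)
  have hupos : ∀ i, (u₀ : ℝ) ≤ u₀ * g ^ i := fun i =>
    le_mul_of_one_le_right (by linarith) (one_le_pow₀ hg1.le)
  -- properties of the anchors of the rounds
  have hdvd : ∀ i < N, ∃ w, w = u₀ / 2 * 2 ^ e i ∧ 1 ≤ w ∧ u₀ * 2 ^ e i = 2 * w ∧ w ∣ h ∧
      4 * w ≤ h := by
    intro i hi
    obtain ⟨k, rfl⟩ : ∃ k, K = k + 1 := ⟨K - 1, by omega⟩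
    have e1 : u₀ = 2 * 2 ^ k := by rw [hu₀, pow_succ']
    have e2 : u₀ / 2 = 2 ^ k := by omega
    have e3 : u₀ * 2 ^ e i = 2 * 2 ^ (k + e i) := by rw [e1, pow_add]; ring
    have hlt : u₀ * 2 ^ e i < h := by
      have := (he1 i hi).trans_lt (hNmin i hi)
      exact_mod_cast this
    rw [e3, ← pow_succ', hh] at hlt
    -- A strict inequality between powers of two gains a factor two: `2 * w < h` yields `w ∣ h` and
    -- `4 * w ≤ h`.
    have hlt' := (Nat.pow_lt_pow_iff_right (by simp)).1 hlt
    refine ⟨2 ^ (k + e i), by rw [e2, pow_add], Nat.one_le_two_pow, e3,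
      hh ▸ pow_dvd_pow _ (by omega), ?_⟩
    calc 4 * 2 ^ (k + e i) = 2 ^ (k + e i + 2) := by ring
      _ ≤ h := hh ▸ Nat.pow_le_pow_right (by simp) (by omega)
  have hh1 : 1 ≤ h := Nat.one_le_two_pow
  obtain ⟨D, hD⟩ : ∃ D : ℕ → ℕ, D = fun i => anchorDist n (u₀ / 2 * 2 ^ e i) c := ⟨_, rfl⟩
  obtain ⟨v, hv⟩ : ∃ v : ℕ → ℕ, v = fun i => ⌊(u₀ : ℝ) * g ^ i⌋₊ := ⟨_, rfl⟩
  have hvle : ∀ i, (v i : ℝ) ≤ u₀ * g ^ i := fun i => by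
    rw [hv]; exact Nat.floor_le (by linarith [hupos i])
  have hvlt : ∀ i, (u₀ : ℝ) * g ^ i < v i + 1 := fun i => by
    rw [hv]; exact Nat.lt_floor_add_one _
  have hP0 : v 0 ≤ r + D 0 := by
    have : v 0 = u₀ := by simp [hv]
    omega
  -- The last round whose certified radius `v i - D i` is at most `r`, written additively to avoid
  -- truncated subtraction.
  obtain ⟨i, hi⟩ : ∃ i, i = Nat.findGreatest (fun i => v i ≤ r + D i) (N - 1) := ⟨_, rfl⟩
  have hiN : i < N := by
    have := Nat.findGreatest_le (P := fun i => v i ≤ r + D i) (N - 1)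
    omega
  have hPi : v i ≤ r + D i :=
    hi ▸ Nat.findGreatest_spec (P := fun i => v i ≤ r + D i) (Nat.zero_le _) hP0
  have hPs : i + 1 < N → r + D (i + 1) < v (i + 1) := fun h' =>
    not_le.1 (Nat.findGreatest_is_greatest (P := fun i => v i ≤ r + D i) (n := N - 1)
      (by omega) (by omega))
  obtain ⟨w, hw, hw1, hw2, hw3, hw4⟩ := hdvd i hiN
  have hwn : w ∣ n := hn ▸ hw3.mul_left 2
  have hvw : 2 * w ≤ v i := by
    rw [hv]
    refine Nat.le_floor ?_
    have := he1 i hiN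
    rw [← hw2]; push_cast; exact this
  have hDi : D i = anchorDist n w c := by rw [hD, hw]
  have hD4 : 2 * D i ≤ w := by
    rw [hDi]
    by_cases hc : w ≤ 2 * c
    · exact two_mul_anchorDist_le (by omega) hwn hw1 (by omega) hc
    -- Here `D i ≤ w - c` and `r < c` would give `v i ≤ r + D i < w`, against `2 * w ≤ v i`.
    · have := anchorDist_le (n := n) (c := c) (d := w - c) hw1 (by omega) dvd_rfl (by omega)
      omega
  have hR : v i - D i ≤ R c := by
    obtain ⟨a, ha1, ha2, ha3, ha4⟩ := exists_anchorDist c (by omega) hwn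
    rw [← hDi] at ha4
    have := he3 i hiN a ha1 ha2 (hw ▸ ha3) c (D i) ha4
    simp only [hv] at hvw hPi ⊢
    exact this (by omega) ((hr _).2 (by omega))
  have hR' : (v i : ℝ) - D i ≤ R c := by
    rw [← Nat.cast_sub (by omega)]; exact_mod_cast hR
  have hwu : 2 * (w : ℝ) ≤ u₀ * g ^ i := by
    have h1 : ((2 * w : ℕ) : ℝ) ≤ v i := by exact_mod_cast hvw
    push_cast at h1
    linarith [hvle i]
  have hD4' : 2 * (D i : ℝ) ≤ w := by exact_mod_cast hD4
  suffices H : (r : ℝ) ≤ (1 + 2 * (ε / 2)) * ((v i : ℝ) - D i) by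
    calc (r : ℝ) ≤ (1 + 2 * (ε / 2)) * ((v i : ℝ) - D i) := H
      _ = (1 + ε) * ((v i : ℝ) - D i) := by ring
      _ ≤ _ := mul_le_mul_of_nonneg_left hR' (by linarith)
  by_cases hlast : i + 1 < N
  · refine window_ratio_step (by linarith) (u := u₀ * g ^ i) (by linarith [hupos i]) (hvlt i)
      (by linarith) ?_
    -- Later anchors are a subset of the earlier ones, so the distance cannot shrink.
    have hDD : D i ≤ D (i + 1) := by
      obtain ⟨w', hw', _, _, hw3', _⟩ := hdvd (i + 1) hlast
      have hee : e i ≤ e (i + 1) := by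
        have h1 := he1 i hiN
        have h2 := he2 (i + 1) hlast
        have h3 : (u₀ : ℝ) * g ^ i ≤ u₀ * g ^ (i + 1) :=
          mul_le_mul_of_nonneg_left (pow_le_pow_right₀ hg1.le (by omega)) (by linarith)
        have h4 : (2 : ℝ) ^ e i < 2 ^ (e (i + 1) + 1) :=
          lt_of_mul_lt_mul_left (h1.trans_lt (h3.trans_lt h2)) (by linarith)
        have := (pow_lt_pow_iff_right₀ (by norm_num)).1 h4
        omega
      rw [hD]
      refine anchorDist_mono c (by omega) (mul_dvd_mul_left _ (pow_dvd_pow _ hee)) ?_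
      rw [← hw']
      exact hn ▸ hw3'.mul_left 2
    have h1 : r + D i + 1 ≤ v (i + 1) := by have := hPs hlast; omega
    have h2 : (r : ℝ) + D i + 1 ≤ v (i + 1) := by exact_mod_cast h1
    have h3 := hvle (i + 1)
    rw [pow_succ] at h3
    rw [← hg]
    linarith
  · obtain rfl : N = i + 1 := by omega
    have hlast : (h : ℝ) ≤ g * (u₀ * g ^ i) := by
      rw [pow_succ] at hNspec; linarith
    -- The midpoint `h` is an anchor, and `r` is limited by the border nearer to `c`; the distances
    -- from `c` to these two add up to at most `h`.
    have hrD : r + D i ≤ h := by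
      rw [hDi]
      rcases le_total c h with hc | hc
      · have := anchorDist_le (n := n) (c := c) (d := h - c) hh1 (by omega) hw3 (by omega)
        omega
      · have := anchorDist_le (n := n) (c := c) (d := c - h) hh1 (by omega) hw3 (by omega)
        omega
    have hrD' : (r : ℝ) + D i ≤ h := by exact_mod_cast hrD
    have hu2 : 2 * u₀ ≤ h := by
      have : u₀ ≤ u₀ * 2 ^ e i := Nat.le_mul_of_pos_right _ (by positivity)
      omega
    have hu2' : 2 * (u₀ : ℝ) ≤ h := by exact_mod_cast hu2
    rcases le_or_gt 16 h with h16 | h16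
    · have h16' : (16 : ℝ) ≤ h := by exact_mod_cast h16
      refine window_ratio_last (h := h) (u := u₀ * g ^ i) (by linarith) (by linarith) h16' ?_ hlast
        (hvlt i) ?_ hrD'
      · nlinarith
      · have : 4 * (w : ℝ) ≤ h := by exact_mod_cast hw4
        linarith
    -- Since `h ≥ 2 * u₀ ≥ 8`, only `h = 8`, `u₀ = 4`, `ε = 1 / 2` remains. The general estimate is
    -- too coarse here, but integrality lifts `v i > 5` to `6`.
    · have hm3 : m < 4 := by
        by_contra h'
        have : 2 ^ 4 ≤ h := hh ▸ Nat.pow_le_pow_right (by simp) (by omega)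
        omega
      have hm : m = 3 := by
        interval_cases m <;> simp at hh <;> omega
      have h8 : h = 8 := by rw [hh, hm]; rfl
      have hu₀4 : u₀ = 4 := by omega
      have hε2 : ε = 1 / 2 := by
        rw [hu₀4] at hδ
        push_cast at hδ
        linarith
      have hD1 : D i ≤ 1 := by omega
      have hv6 : 6 ≤ v i := by
        rw [h8, hg, hε2] at hlast
        push_cast at hlast
        have h1 := hvlt i
        rw [hg, hε2] at h1
        have h2 : (5 : ℝ) < v i := by linarith
        exact_mod_cast h2
      have hv6' : (6 : ℝ) ≤ v i := by exact_mod_cast hv6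
      have hD1' : (D i : ℝ) ≤ 1 := by exact_mod_cast hD1
      rw [h8] at hrD'
      push_cast at hrD'
      rw [hε2]
      linarith

end WildPal

/-! ### Numerical bounds for the number of rounds and the running time. -/

namespace WildPal

theorem clog_add_one_le {n : ℕ} (hn : 2 ≤ n) :
    ((Nat.clog 2 (2 * n) + 1 : ℕ) : ℝ) ≤ 6 * Real.log n := by
  have hl2 := Real.log_two_gt_d9
  have hln : Real.log 2 ≤ Real.log n := Real.log_le_log (by simp) (by exact_mod_cast hn)
  obtain ⟨k, hk⟩ : ∃ k, Nat.clog 2 (2 * n) = k + 1 :=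
    ⟨_, (Nat.succ_pred_eq_of_pos (Nat.clog_pos (by simp) (by omega))).symm⟩
  have h1 : 2 ^ k < 2 * n := (Nat.lt_clog_iff_pow_lt (by simp)).1 (by omega)
  have h2 : (k : ℝ) * Real.log 2 ≤ Real.log 2 + Real.log n := by
    rw [← Real.log_pow, ← Real.log_mul (by simp) (by positivity)]
    exact Real.log_le_log (by positivity) (by exact_mod_cast h1.le)
  rw [hk]
  push_cast
  have h3 : (k : ℝ) * 0.69 ≤ k * Real.log 2 :=
    mul_le_mul_of_nonneg_left (by linarith) (Nat.cast_nonneg _)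
  linarith

/-- `log (1 + y) ≥ y / (1 + y) ≥ y / 2` at `y = ε / 2` shows that `4 / ε * log n` rounds suffice;
the fifth unit pays for rounding up. -/
theorem exists_num_rounds {n : ℕ} {ε : ℝ} (hn : 2 ≤ n) (hε : 0 < ε) (hε' : ε ≤ 1 / 2) :
    ∃ J : ℕ, (n : ℝ) ≤ (1 + ε / 2) ^ J ∧ (J : ℝ) ≤ 5 * (1 / ε * Real.log n) := by
  have hl2 := Real.log_two_gt_d9
  have hln : Real.log 2 ≤ Real.log n := Real.log_le_log (by simp) (by exact_mod_cast hn)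
  have hg : ε / 4 ≤ Real.log (1 + ε / 2) := by
    refine le_trans ?_ (Real.one_sub_inv_le_log_of_pos (by linarith))
    have h1 : (1 + ε / 2) * (1 + ε / 2)⁻¹ = 1 := mul_inv_cancel₀ (by linarith)
    have h2 : 0 < (1 + ε / 2)⁻¹ := inv_pos.2 (by linarith)
    nlinarith
  have hn0 : (0 : ℝ) < n := by positivity
  refine ⟨⌈4 / ε * Real.log n⌉₊, ?_, ?_⟩
  · rw [← Real.log_le_log_iff hn0 (by positivity), Real.log_pow]
    have h1 := Nat.le_ceil (4 / ε * Real.log n)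
    calc Real.log n = 4 / ε * Real.log n * (ε / 4) := by field_simp
      _ ≤ _ := mul_le_mul h1 hg (by positivity) (by positivity)
  · have h0 : 0 ≤ 4 / ε * Real.log n := mul_nonneg (by positivity) (by linarith)
    have h1 := (Nat.ceil_lt_add_one h0).le
    have h2 : 2 ≤ 1 / ε := by rw [le_div_iff₀ hε]; linarith
    have h3 : 2 * Real.log n ≤ 1 / ε * Real.log n := mul_le_mul_of_nonneg_right h2 (by linarith)
    have h4 : 4 / ε * Real.log n = 4 * (1 / ε * Real.log n) := by ring
    linarith

theorem two_pow_clog_ceil_le {t : ℝ} (ht : 1 < t) : ((2 ^ Nat.clog 2 ⌈t⌉₊ : ℕ) : ℝ) ≤ 2 * t := by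
  have h1 : 1 < ⌈t⌉₊ := by rw [Nat.lt_ceil]; simpa
  obtain ⟨k, hk⟩ : ∃ k, Nat.clog 2 ⌈t⌉₊ = k + 1 :=
    ⟨_, (Nat.succ_pred_eq_of_pos (Nat.clog_pos (by simp) h1)).symm⟩
  have h2 : 2 ^ k < ⌈t⌉₊ := (Nat.lt_clog_iff_pow_lt (by simp)).1 (by omega)
  have h3 := Nat.lt_ceil.1 h2
  rw [hk, pow_succ]
  push_cast at h3 ⊢
  linarith

/-- The rounds contribute `5 * 8102 * 6 = 243060`; the initialization, linear in `n / ε`, is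
absorbed because `l ^ 2 ≥ 0.47`. -/
theorem time_bound {n J L P : ℕ} {ε l : ℝ} (hε : 0 < ε) (hε' : ε ≤ 1 / 2) (hl : 0.69 ≤ l)
    (hP : (P : ℝ) ≤ 4 * (1 / ε)) (hJ : (J : ℝ) ≤ 5 * (1 / ε * l)) (hL : ((L + 1 : ℕ) : ℝ) ≤ 6 * l) :
    ((110 * n * P + J * (8102 * n * (L + 1)) : ℕ) : ℝ) ≤ 300000 * (1 / ε * n * l ^ 2) := by
  have hn : (0 : ℝ) ≤ n := Nat.cast_nonneg _
  have he : 0 < 1 / ε := by positivity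
  push_cast at hL ⊢
  have h1 : 110 * (n : ℝ) * P ≤ 110 * n * (4 * (1 / ε)) :=
    mul_le_mul_of_nonneg_left hP (by positivity)
  have h2 : (J : ℝ) * (8102 * n * (L + 1)) ≤ 5 * (1 / ε * l) * (8102 * n * (6 * l)) :=
    mul_le_mul hJ (mul_le_mul_of_nonneg_left hL (by positivity)) (by positivity) (by positivity)
  have h3 : 0.47 ≤ l ^ 2 := by nlinarith
  have h4 : 1 / ε * n * 0.47 ≤ 1 / ε * n * l ^ 2 := mul_le_mul_of_nonneg_left h3 (by positivity)
  have h5 : 0 ≤ 1 / ε * n := by positivity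
  nlinarith

end WildPal

/-! ### The main theorem. -/

theorem mainTheorem3 :
    ∃ C : ℝ, 0 < C ∧
      ∀ (α : Type*) (code : α ↪ ℕ) (S : List (Option α)) (ε : ℝ),
        2 ≤ S.length → 0 < ε → ε ≤ 1 / 2 →
        -- the algorithm terminates in a configuration `m` such that …
        (∃ m : WildPal.Machine,
          ((), m) ∈ (WildPal.approxPal S.length ε).run (WildPal.initial code S) ∧
          -- running time and space
          (m.time : ℝ) ≤ C * ((1 / ε) * S.length * Real.log S.length ^ 2) ∧
          (m.space : ℝ) ≤ C * S.length ∧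
          -- number of rounds; number and size of the convolutions of each round
          (m.rounds.length : ℝ) ≤ C * ((1 / ε) * Real.log S.length) ∧
          (∀ p ∈ m.rounds, 0 < p.1 ∧
            (p.2.length : ℝ) ≤ C * (S.length / p.1) ∧ ∀ k ∈ p.2, (k : ℝ) ≤ C * p.1) ∧
          -- the output is a `(1 + ε)`-approximation of all maximal radii
          ((∃ k : ℕ, S.length = 2 ^ k) →
            ∀ c : ℕ, 1 ≤ c → c ≤ S.length →
              ∃ r : ℕ, WildPal.IsMaximalRadius S c r ∧
                m.nat .rad c ≤ r ∧ (r : ℝ) ≤ (1 + ε) * (m.nat .rad c : ℝ))) ∧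
        -- the convolution subroutine computes the matching self-convolution of every factor
        (∀ (m : WildPal.Machine) (l r : ℕ), m.nat .str = WildPal.inputArray code S →
          1 ≤ l → l ≤ r → r ≤ S.length →
          ∃ m' : WildPal.Machine, ((), m') ∈ (WildPal.mconvProg l r).run m ∧
            ∀ i : ℕ, 1 ≤ i → i ≤ 2 * (r - l + 1) - 1 →
              m'.nat .mat i =
                WildPal.mconv (WildPal.factor S l r) (WildPal.factor S l r).reverse i) := by
  refine ⟨300000, by norm_num, fun α code S ε hn hε hε' => ⟨?_, fun m l r hm hl hlr hr =>
    WildPal.mconvProg_correct code S m l r hm hl hlr hr⟩⟩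
  set n := S.length with hndef
  obtain ⟨J, hJ1, hJ2⟩ := WildPal.exists_num_rounds hn hε hε'
  obtain ⟨K, hK⟩ : ∃ K, K = Nat.clog 2 ⌈1 / (ε / 2)⌉₊ := ⟨_, rfl⟩
  have ht : 1 / (ε / 2) = 2 * (1 / ε) := by field_simp
  have he2 : 2 ≤ 1 / ε := by rw [le_div_iff₀ hε]; linarith
  have hKceil : ⌈1 / (ε / 2)⌉₊ ≤ 2 ^ K := hK ▸ Nat.le_pow_clog (by simp) _
  have hKge : 1 / (ε / 2) ≤ ((2 ^ K : ℕ) : ℝ) := (Nat.le_ceil _).trans (Nat.cast_le.2 hKceil)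
  have hKle : ((2 ^ K : ℕ) : ℝ) ≤ 4 * (1 / ε) := by
    rw [hK]
    exact (WildPal.two_pow_clog_ceil_le (by rw [ht]; linarith)).trans (by rw [ht]; linarith)
  have hK2 : 2 ≤ K := by
    by_contra h
    have : 2 ^ K ≤ 2 ^ 1 := Nat.pow_le_pow_right (by simp) (by omega)
    have : ((2 ^ K : ℕ) : ℝ) ≤ 2 := by exact_mod_cast this
    rw [ht] at hKge
    linarith
  have hlog : 0.69 ≤ Real.log n := by
    have h1 := Real.log_two_gt_d9
    have h2 : Real.log 2 ≤ Real.log n := Real.log_le_log (by simp) (by exact_mod_cast hn)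
    linarith
  obtain ⟨_, m, hm, htime, hspace, j, hj, s, hI, hs⟩ :=
    WildPal.runs_approxPal (B := 4 * n + 1) hn (by omega) hε hε' hK hJ1 (M := (WildPal.initial code S).mem)
      (x := WildPal.inputArray code S) rfl rfl (WildPal.initial code S) rfl
      ⟨fun _ => Nat.zero_le _, fun _ => Nat.zero_le _⟩
  refine ⟨m, hm, ?_, ?_, ?_, ?_, ?_⟩
  · have h0 : (WildPal.initial code S).time = 0 := rfl
    rw [h0, zero_add] at htime
    exact (Nat.cast_le.2 htime).trans
      (WildPal.time_bound hε hε' hlog hKle hJ2 (WildPal.clog_add_one_le hn))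
  · have h1 : m.space ≤ 9 * (4 * n + 1) := by
      obtain ⟨g1, g2⟩ := hspace
      have := g1 .str
      have := g1 .rad
      have := g1 .anch
      have := g1 .mat
      have := g2 .x1
      have := g2 .x2
      have := g2 .x3
      have := g2 .tmp
      have := g2 .root
      unfold WildPal.Machine.space
      omega
    have h2 : m.space ≤ 300000 * n := by omega
    exact_mod_cast h2
  · have h1 : m.rounds.length = j := hI.rounds_length
    have h2 : (j : ℝ) ≤ J := by exact_mod_cast hj
    have h3 : 0 ≤ 1 / ε * Real.log n := by positivity
    rw [h1]
    linarith
  · intro p hp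
    obtain ⟨h1, h2, h3⟩ := hI.rounds p hp
    refine ⟨h1, ?_, fun k hk => (h3 k hk).trans (by linarith)⟩
    rw [← mul_div_assoc, le_div_iff₀ h1]
    have : (0 : ℝ) ≤ n := Nat.cast_nonneg _
    linarith
  · rintro ⟨k, hk⟩ c hc hcn
    obtain ⟨r, hr1, hr2, hr3⟩ := WildPal.exists_maximal_radius (x := WildPal.inputArray code S) hc hcn
    refine ⟨r, (WildPal.isMaximalRadius_iff code S).2 ⟨hr1, hr2⟩, (hr3 _).1 (hI.palAt c hc hcn), ?_⟩
    obtain ⟨k, rfl⟩ : ∃ i, k = i + 1 := ⟨k - 1, by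
      rcases k with _ | k
      · simp at hk; omega
      · rfl⟩
    refine WildPal.approx_of_treated (hk.trans (pow_succ' 2 k)) rfl hK2 ?_ hε hε' (hI.u_eq ▸ hs) hr3
      (hI.naive c hc hcn) hI.treated
    rw [div_le_iff₀ (by linarith)] at hKge
    linarith
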